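/- Let $\alpha,\beta>0$ with $\alpha\beta>1$. In $L^2(\mathbb R)$ let $a=\frac1{\sqrt2}\left(\frac{d}{dx}+x\right)$ and $a^*=\frac1{\sqrt2}\left(-\frac{d}{dx}+x\right)$, and put $\sigma_x=\begin{pmatrix}0&1\\1&0\end{pmatrix}$, $\sigma_z=\begin{pmatrix}1&0\\0&-1\end{pmatrix}$. In $\mathcal H=\mathbb C^2\otimes L^2(\mathbb R)$ consider the non-commutative harmonic oscillator $$Q^{\rm NH}_{\alpha\beta}=\begin{pmatrix}\alpha&0\\0&\beta\end{pmatrix}\otimes\left(a^*a+\tfrac12\right)+\tfrac12\begin{pmatrix}0&-1\\1&0\end{pmatrix}\otimes\left(a^2-(a^*)^2\right)$$ and, for $\Delta,g\in\mathbb R$ with $|g|<\frac12$, the two-photon quantum Rabi model $$H^{\rm 2p}_{\Delta,g}=\Delta\,\sigma_z\otimes 1+1\otimes\left(a^*a+\tfrac12\right)+g\,\sigma_x\otimes\left(a^2+(a^*)^2\right),$$ both with domain $\mathbb C^2\otimes D(a^*a)$. Let $\mathcal H_{\alpha\beta}$ be the space $\mathcal H$ with the inner product $(f,g)_{\alpha\beta}=(f,\gamma_{\alpha\beta}g)$,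 $\gamma_{\alpha\beta}=\begin{pmatrix}1/\alpha&0\\0&1/\beta\end{pmatrix}\otimes 1$. Let $$I_{\alpha\beta}=c\otimes e^{-i(\pi/4)a^*a},\qquad c=\begin{pmatrix}\sqrt\alpha&0\\0&\sqrt\beta\end{pmatrix}e^{i(\pi/4)\sigma_z}.$$ For $\lambda\in\mathbb R$ let $H^{\rm 2p}_{\alpha\beta}(\lambda)$ be $H^{\rm 2p}_{\Delta,g}$ with $\Delta=\frac{\alpha-\beta}{2\alpha\beta}\lambda$ and $g=\frac1{2\sqrt{\alpha\beta}}$, regarded as an operator in $\mathcal H_{\alpha\beta}$, let $\mathcal E_\lambda$ be the space of its eigenvectors for the eigenvalue $\frac{\alpha+\beta}{2\alpha\beta}\lambda$ (together with $0$), and let $P_{\frac{\alpha+\beta}{2\alpha\beta}\lambda}$ be the orthogonal projection of $\mathcal H_{\alpha\beta}$ onto $\mathcal E_\lambda$. Then the spectrum $\sigma(Q^{\rm NH}_{\alpha\beta})$ is real, $\mathcal E_\lambda\neq\{0\}$ for each $\lambda\in\sigma(Q^{\rm NH}_{\alpha\beta})$, $\mathcal H_{\alpha\beta}$ is the Hilbert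 space direct sum of the spaces $\mathcal E_\lambda$, $\lambda\in\sigma(Q^{\rm NH}_{\alpha\beta})$, the map $I_{\alpha\beta}$ is unitary from $\mathcal H$ onto $\mathcal H_{\alpha\beta}$, and $$I_{\alpha\beta}\,Q^{\rm NH}_{\alpha\beta}\,I_{\alpha\beta}^{-1}=\frac{2\alpha\beta}{\alpha+\beta}\bigoplus_{\lambda\in\sigma(Q^{\rm NH}_{\alpha\beta})}H^{\rm 2p}_{\alpha\beta}(\lambda)\,P_{\frac{\alpha+\beta}{2\alpha\beta}\lambda}$$ as operators in $\mathcal H_{\alpha\beta}$, including equality of domains; here $\bigoplus$ is the direct sum of operators in $\mathcal H_{\alpha\beta}$, whose domain consists of all $f$ such that $P_{\frac{\alpha+\beta}{2\alpha\beta}\lambda}f$ lies in the domain of $H^{\rm 2p}_{\alpha\beta}(\lambda)$ for every $\lambda$ and $\sum_\lambda\left\|H^{\rm 2p}_{\alpha\beta}(\lambda)P_{\frac{\alpha+\beta}{2\alpha\beta}\lambda}f\right\|_{\alpha\beta}^2<\infty$. -/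

import Mathlib

open MeasureTheory
open scoped SchwartzMap

namespace NcHO

noncomputable section

/-! ### Generalities on partially defined (unbounded) operators -/

section Generalities

variable {E F K ι : Type*}

/-- The product `g f` of unbounded operators on its natural domain
`{x ∈ D(f) | f x ∈ D(g)}`. -/
def pcomp [AddCommGroup E] [Module ℂ E] (g f : E →ₗ.[ℂ] E) : E →ₗ.[ℂ] E where
  domain :=
    { carrier := {x | ∃ hx : x ∈ f.domain, f ⟨x, hx⟩ ∈ g.domain}
      zero_mem' := ⟨f.domain.zero_mem, by
        have h : f ⟨0, f.domain.zero_mem⟩ = 0 := f.map_zero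
        rw [h]; exact g.domain.zero_mem⟩
      add_mem' := by
        rintro x y ⟨hx, hx'⟩ ⟨hy, hy'⟩
        refine ⟨f.domain.add_mem hx hy, ?_⟩
        have h : f ⟨x + y, f.domain.add_mem hx hy⟩ = f ⟨x, hx⟩ + f ⟨y, hy⟩ :=
          f.map_add ⟨x, hx⟩ ⟨y, hy⟩
        rw [h]; exact g.domain.add_mem hx' hy'
      smul_mem' := by
        rintro c x ⟨hx, hx'⟩
        refine ⟨f.domain.smul_mem c hx, ?_⟩
        have h : f ⟨c • x, f.domain.smul_mem c hx⟩ = c • f ⟨x, hx⟩ := f.map_smul c ⟨x, hx⟩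
        rw [h]; exact g.domain.smul_mem c hx' }
  toFun :=
    { toFun := fun x => g ⟨f ⟨x.1, x.2.1⟩, x.2.2⟩
      map_add' := by
        rintro ⟨x, hx, hx'⟩ ⟨y, hy, hy'⟩
        rw [← g.map_add]
        exact congrArg g (Subtype.ext (f.map_add ⟨x, hx⟩ ⟨y, hy⟩))
      map_smul' := by
        rintro c ⟨x, hx, hx'⟩
        rw [RingHom.id_apply, ← g.map_smul]
        exact congrArg g (Subtype.ext (f.map_smul c ⟨x, hx⟩)) }

/-- The everywhere defined operator given by a linear map. -/
def everywhere [AddCommGroup E] [Module ℂ E] (f : E →ₗ[ℂ] E) : E →ₗ.[ℂ] E := f.toPMap ⊤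

/-- The operator `e T e⁻¹` on `F`, with domain `e D(T)`, for a linear bijection `e : E → F`. -/
def conj [AddCommGroup E] [Module ℂ E] [AddCommGroup F] [Module ℂ F]
    (e : E ≃ₗ[ℂ] F) (T : E →ₗ.[ℂ] E) : F →ₗ.[ℂ] F where
  domain := T.domain.comap e.symm.toLinearMap
  toFun :=
    { toFun := fun x => e (T ⟨e.symm x.1, x.2⟩)
      map_add' := by
        rintro ⟨x, hx⟩ ⟨y, hy⟩
        rw [← map_add e, ← T.map_add]
        exact congrArg (fun z => e (T z)) (Subtype.ext (map_add e.symm x y))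
      map_smul' := by
        rintro c ⟨x, hx⟩
        rw [RingHom.id_apply, ← map_smul e, ← T.map_smul]
        exact congrArg (fun z => e (T z)) (Subtype.ext (map_smul e.symm c x)) }

/-- The eigenspace `{x ∈ D(T) | T x = μ x}`. -/
def eigenspace [AddCommGroup E] [Module ℂ E] (T : E →ₗ.[ℂ] E) (μ : ℂ) : Submodule ℂ E where
  carrier := {x | ∃ hx : x ∈ T.domain, T ⟨x, hx⟩ = μ • x}
  zero_mem' := ⟨T.domain.zero_mem, by rw [smul_zero]; exact T.map_zero⟩
  add_mem' := by
    rintro x y ⟨hx, hx'⟩ ⟨hy, hy'⟩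
    refine ⟨T.domain.add_mem hx hy, ?_⟩
    rw [smul_add, ← hx', ← hy']
    exact T.map_add ⟨x, hx⟩ ⟨y, hy⟩
  smul_mem' := by
    rintro c x ⟨hx, hx'⟩
    refine ⟨T.domain.smul_mem c hx, ?_⟩
    rw [smul_comm, ← hx']
    exact T.map_smul c ⟨x, hx⟩

/-- The orthogonal projection onto the eigenspace of `T` for `μ`. An eigenspace of a closed
operator is closed, so that the closure changes nothing for such operators; it makes the
projection available before closedness is known. -/
def eigenprojection [NormedAddCommGroup E] [InnerProductSpace ℂ E] [CompleteSpace E]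
    (T : E →ₗ.[ℂ] E) (μ : ℂ) : E →L[ℂ] E :=
  (eigenspace T μ).topologicalClosure.starProjection

/-- The spectrum of an unbounded operator: the set of all `z ∈ ℂ` such that `T - z` has no
bounded everywhere defined two-sided inverse. -/
def spectrum [NormedAddCommGroup E] [InnerProductSpace ℂ E] (T : E →ₗ.[ℂ] E) : Set ℂ :=
  {z | ¬ ∃ R : E →L[ℂ] E,
    (∀ y, ∃ h : R y ∈ T.domain, T ⟨R y, h⟩ - z • R y = y) ∧
      ∀ x : T.domain, R (T x - z • (x : E)) = x}

/-- The direct sum `⨁ i, T i` of operators whose values lie in mutually orthogonal subspaces of a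
Hilbert space: its domain consists of the `x ∈ ⋂ i, D(T i)` for which `∑ i, T i x` converges, and
the sum is its value. By `mem_directSum_domain_iff`, convergence means `∑ i, ‖T i x‖ ^ 2 < ∞`. -/
def directSum [NormedAddCommGroup K] [InnerProductSpace ℂ K] (T : ι → K →ₗ.[ℂ] K) :
    K →ₗ.[ℂ] K where
  domain :=
    { carrier := {x | ∃ h : ∀ i, x ∈ (T i).domain, Summable fun i => T i ⟨x, h i⟩}
      zero_mem' := ⟨fun i => (T i).domain.zero_mem, by
        have h : (fun i => T i ⟨0, (T i).domain.zero_mem⟩) = fun _ => 0 :=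
          funext fun i => (T i).map_zero
        rw [h]; exact summable_zero⟩
      add_mem' := by
        rintro x y ⟨hx, hx'⟩ ⟨hy, hy'⟩
        refine ⟨fun i => (T i).domain.add_mem (hx i) (hy i), ?_⟩
        exact (hx'.add hy').congr fun i => ((T i).map_add ⟨x, hx i⟩ ⟨y, hy i⟩).symm
      smul_mem' := by
        rintro c x ⟨hx, hx'⟩
        refine ⟨fun i => (T i).domain.smul_mem c (hx i), ?_⟩
        exact (hx'.const_smul c).congr fun i => ((T i).map_smul c ⟨x, hx i⟩).symm }
  toFun :=
    { toFun := fun x => ∑' i, T i ⟨x.1, x.2.1 i⟩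
      map_add' := by
        rintro ⟨x, hx, hx'⟩ ⟨y, hy, hy'⟩
        rw [← hx'.tsum_add hy']
        exact tsum_congr fun i => (T i).map_add ⟨x, hx i⟩ ⟨y, hy i⟩
      map_smul' := by
        rintro c ⟨x, hx, hx'⟩
        rw [RingHom.id_apply, ← hx'.tsum_const_smul c]
        exact tsum_congr fun i => (T i).map_smul c ⟨x, hx i⟩ }

theorem mem_directSum_domain_iff [NormedAddCommGroup K] [InnerProductSpace ℂ K] [CompleteSpace K]
    (T : ι → K →ₗ.[ℂ] K) (V : ι → Submodule ℂ K)
    (hV : OrthogonalFamily ℂ (fun i => V i) fun i => (V i).subtypeₗᵢ)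
    (hT : ∀ i x, T i x ∈ V i) (x : K) :
    x ∈ (directSum T).domain ↔
      ∃ h : ∀ i, x ∈ (T i).domain, Summable fun i => ‖T i ⟨x, h i⟩‖ ^ 2 :=
  exists_congr fun h =>
    hV.summable_iff_norm_sq_summable fun i => (⟨T i ⟨x, h i⟩, hT i _⟩ : V i)

end Generalities

/-! ### Annihilation and creation operators in `L²(ℝ)` -/

/-- `L²(ℝ)`. -/
abbrev L2 : Type := Lp ℂ 2 (volume : Measure ℝ)

/-- The graph of `d/dx` in `L²(ℝ)`: the pairs `(f, g)` such that `g` is the distributional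
derivative of `f`. -/
def derivGraph : Submodule ℂ (L2 × L2) :=
  LinearMap.ker
    (((TemperedDistribution.derivCLM ℂ).toLinearMap ∘ₗ
        (Lp.toTemperedDistributionCLM ℂ (volume : Measure ℝ) 2).toLinearMap ∘ₗ
          LinearMap.fst ℂ L2 L2) -
      (Lp.toTemperedDistributionCLM ℂ (volume : Measure ℝ) 2).toLinearMap ∘ₗ
        LinearMap.snd ℂ L2 L2)

theorem mem_derivGraph_iff (f g : L2) :
    (f, g) ∈ derivGraph ↔ TemperedDistribution.derivCLM ℂ (f : 𝓢'(ℝ, ℂ)) = (g : 𝓢'(ℝ, ℂ)) := by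
  simp only [derivGraph, LinearMap.mem_ker, LinearMap.sub_apply, sub_eq_zero]
  rfl

/-- The operator `d/dx` in `L²(ℝ)`, on the set of all `f ∈ L²(ℝ)` whose distributional derivative
is in `L²(ℝ)`. -/
def derivOp : L2 →ₗ.[ℂ] L2 := derivGraph.toLinearPMap

theorem derivOp_graph : derivOp.graph = derivGraph := by
  refine Submodule.toLinearPMap_graph_eq _ ?_
  rintro ⟨f, g⟩ hfg (rfl : f = 0)
  rw [mem_derivGraph_iff] at hfg
  have h0 : Lp.toTemperedDistributionCLM ℂ (volume : Measure ℝ) 2 g = 0 := by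
    refine Eq.trans hfg.symm ?_
    have h1 : ((0 : L2) : 𝓢'(ℝ, ℂ)) = 0 :=
      map_zero (Lp.toTemperedDistributionCLM ℂ (volume : Measure ℝ) 2)
    rw [h1, map_zero]
  have h2 : g ∈ (Lp.toTemperedDistributionCLM ℂ (volume : Measure ℝ) 2).ker := h0
  rw [Lp.ker_toTemperedDistributionCLM_eq_bot] at h2
  exact h2

/-- The graph of multiplication by `x` in `L²(ℝ)`. -/
def posGraph : Submodule ℂ (L2 × L2) where
  carrier := {p | ∀ᵐ x : ℝ, p.2 x = (x : ℂ) * p.1 x}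
  zero_mem' := by
    filter_upwards [Lp.coeFn_zero ℂ 2 (volume : Measure ℝ)] with x hx
    rw [Prod.snd_zero, Prod.fst_zero, hx, Pi.zero_apply, mul_zero]
  add_mem' := by
    rintro ⟨f, g⟩ ⟨f', g'⟩ h h'
    filter_upwards [h, h', Lp.coeFn_add f f', Lp.coeFn_add g g'] with x h1 h2 h3 h4
    simp only [Prod.mk_add_mk, h3, h4, Pi.add_apply] at *
    rw [h1, h2, mul_add]
  smul_mem' := by
    rintro c ⟨f, g⟩ h
    filter_upwards [h, Lp.coeFn_smul c f, Lp.coeFn_smul c g] with x h1 h3 h4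
    simp only [Prod.smul_mk, h3, h4, Pi.smul_apply, smul_eq_mul] at *
    rw [h1, mul_left_comm]

/-- The operator of multiplication by `x`, on `{f ∈ L²(ℝ) | x f ∈ L²(ℝ)}`. -/
def posOp : L2 →ₗ.[ℂ] L2 := posGraph.toLinearPMap

theorem posOp_graph : posOp.graph = posGraph := by
  refine Submodule.toLinearPMap_graph_eq _ ?_
  rintro ⟨f, g⟩ hfg (rfl : f = 0)
  refine Lp.ext ?_
  have h : ∀ᵐ x : ℝ, g x = (x : ℂ) * (0 : L2) x := hfg
  filter_upwards [h, Lp.coeFn_zero ℂ 2 (volume : Measure ℝ)] with x h1 h2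
  rw [h1, h2]
  simp

/-- The annihilation operator `a = (d/dx + x) / √2`. -/
def ann : L2 →ₗ.[ℂ] L2 := ((1 / √2 : ℝ) : ℂ) • (derivOp + posOp)

/-- The creation operator `a* = (-d/dx + x) / √2`. -/
def cre : L2 →ₗ.[ℂ] L2 := ((1 / √2 : ℝ) : ℂ) • (-derivOp + posOp)

/-- The number operator `a* a`. -/
def num : L2 →ₗ.[ℂ] L2 := pcomp cre ann

/-- The oscillator Hamiltonian `a* a + 1/2`. -/
def numHalf : L2 →ₗ.[ℂ] L2 := num + everywhere ((1 / 2 : ℂ) • LinearMap.id)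

/-- `exp (-i t a* a)`, the operator which multiplies the eigenspace of `a* a` for the eigenvalue
`n` by `exp (-i t n)`, for each `n = 0, 1, 2, …` -/
def expNum (t : ℝ) (f : L2) : L2 :=
  ∑' n : ℕ, Complex.exp (-Complex.I * t * n) • eigenprojection num n f

/-! ### The two models -/

/-- `ℂ² ⊗ L²(ℝ) = L²(ℝ) ⊕ L²(ℝ)`. -/
abbrev H : Type := PiLp 2 fun _ : Fin 2 => L2

/-- The operator `M ⊗ T` with domain `ℂ² ⊗ D(T) = D(T) ⊕ D(T)`. -/
def tensor (M : Matrix (Fin 2) (Fin 2) ℂ) (T : L2 →ₗ.[ℂ] L2) : H →ₗ.[ℂ] H where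
  domain :=
    { carrier := {f | ∀ i, f i ∈ T.domain}
      zero_mem' := fun _ => T.domain.zero_mem
      add_mem' := fun hf hg i => T.domain.add_mem (hf i) (hg i)
      smul_mem' := fun c _ hf i => T.domain.smul_mem c (hf i) }
  toFun :=
    { toFun := fun f => WithLp.toLp 2 fun i => ∑ j, M i j • T ⟨f.1 j, f.2 j⟩
      map_add' := by
        rintro ⟨f, hf⟩ ⟨g, hg⟩
        ext1 i
        simp only [PiLp.add_apply, ← Finset.sum_add_distrib, ← smul_add]
        exact Finset.sum_congr rfl fun j _ =>
          congrArg (M i j • ·) (T.map_add ⟨f j, hf j⟩ ⟨g j, hg j⟩)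
      map_smul' := by
        rintro c ⟨f, hf⟩
        ext1 i
        simp only [PiLp.smul_apply, Finset.smul_sum, RingHom.id_apply]
        refine Finset.sum_congr rfl fun j _ => ?_
        rw [smul_comm]
        exact congrArg (M i j • ·) (T.map_smul c ⟨f j, hf j⟩) }

/-- The bounded operator `M ⊗ 1`. -/
def matOp (M : Matrix (Fin 2) (Fin 2) ℂ) : H →ₗ[ℂ] H where
  toFun f := WithLp.toLp 2 fun i => ∑ j, M i j • f j
  map_add' f g := by
    ext1 i
    simp [Finset.sum_add_distrib]
  map_smul' c f := by
    ext1 i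
    simp only [PiLp.smul_apply, Finset.smul_sum, RingHom.id_apply]
    exact Finset.sum_congr rfl fun j _ => smul_comm _ _ _

/-- The Pauli matrix `σ_x`. -/
def sigmaX : Matrix (Fin 2) (Fin 2) ℂ := !![0, 1; 1, 0]

/-- The Pauli matrix `σ_z`. -/
def sigmaZ : Matrix (Fin 2) (Fin 2) ℂ := !![1, 0; 0, -1]

/-- The matrix `J = -i σ_y`. -/
def matJ : Matrix (Fin 2) (Fin 2) ℂ := !![0, -1; 1, 0]

/-- The non-commutative harmonic oscillator
`diag(α, β) ⊗ (a* a + 1/2) + (1/2) J ⊗ (a² - a*²)`, on the natural domain of this expression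
(for `α, β > 0`, `α β > 1` this is `ℂ² ⊗ D(a* a)`, on which it is self-adjoint). -/
def ncho (α β : ℝ) : H →ₗ.[ℂ] H :=
  tensor !![(α : ℂ), 0; 0, (β : ℂ)] numHalf +
    (1 / 2 : ℂ) • tensor matJ (pcomp ann ann - pcomp cre cre)

/-- The two-photon quantum Rabi model
`Δ σ_z ⊗ 1 + 1 ⊗ (a* a + 1/2) + g σ_x ⊗ (a² + a*²)`, on the natural domain of this expression
(for `|g| < 1/2` this is `ℂ² ⊗ D(a* a)`, on which it is self-adjoint). -/
def rabi (Δ g : ℝ) : H →ₗ.[ℂ] H :=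
  (Δ : ℂ) • tensor sigmaZ (everywhere LinearMap.id) + tensor 1 numHalf +
    (g : ℂ) • tensor sigmaX (pcomp ann ann + pcomp cre cre)

/-! ### The weighted Hilbert space -/

/-- The operator `γ = diag(1/α, 1/β) ⊗ 1`. -/
def gam (α β : ℝ) : H →ₗ[ℂ] H := matOp !![(1 / α : ℂ), 0; 0, (1 / β : ℂ)]

/-- The space `ℂ² ⊗ L²(ℝ)` with the inner product `(f, γ g)`. -/
def Hab (α β : ℝ) (_ : 0 < α) (_ : 0 < β) : Type := H

section Weighted

variable {α β : ℝ} {hα : 0 < α} {hβ : 0 < β}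

instance : AddCommGroup (Hab α β hα hβ) := inferInstanceAs (AddCommGroup H)

instance : Module ℂ (Hab α β hα hβ) := inferInstanceAs (Module ℂ H)

/-- The identity map, from `ℂ² ⊗ L²(ℝ)` to the same space with the weighted inner product. -/
def toHab (α β : ℝ) (hα : 0 < α) (hβ : 0 < β) : H ≃ₗ[ℂ] Hab α β hα hβ := LinearEquiv.refl ℂ H

theorem inner_gam (f g : H) : inner ℂ f (gam α β g) =
    (1 / α : ℂ) * inner ℂ (f 0) (g 0) + (1 / β : ℂ) * inner ℂ (f 1) (g 1) := by
  simp only [gam, matOp, PiLp.inner_apply, Fin.sum_univ_two, LinearMap.coe_mk, AddHom.coe_mk,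
    Matrix.of_apply, Matrix.cons_val', Matrix.cons_val_zero, Matrix.cons_val_one,
    Matrix.cons_val_fin_one, zero_smul, add_zero, zero_add, inner_smul_right]

theorem re_inner_gam_self (f : H) : (inner ℂ f (gam α β f) : ℂ).re =
    ‖f 0‖ ^ 2 / α + ‖f 1‖ ^ 2 / β := by
  rw [inner_gam, inner_self_eq_norm_sq_to_K, inner_self_eq_norm_sq_to_K]
  have h : (1 / α : ℂ) * ((‖f 0‖ : ℝ) : ℂ) ^ 2 + (1 / β : ℂ) * ((‖f 1‖ : ℝ) : ℂ) ^ 2 =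
      ((‖f 0‖ ^ 2 / α + ‖f 1‖ ^ 2 / β : ℝ) : ℂ) := by
    push_cast; ring
  exact (congrArg Complex.re h).trans (Complex.ofReal_re _)

/-- The weighted inner product `(f, γ g)`. -/
@[reducible]
def habCore (α β : ℝ) (hα : 0 < α) (hβ : 0 < β) : InnerProductSpace.Core ℂ (Hab α β hα hβ) where
  inner f g := inner ℂ ((toHab α β hα hβ).symm f) (gam α β ((toHab α β hα hβ).symm g))
  conj_inner_symm f g := by
    rw [inner_gam, inner_gam]
    simp [inner_conj_symm]
  re_inner_nonneg f := by
    refine le_of_le_of_eq ?_ (re_inner_gam_self _).symm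
    positivity
  add_left f g h := by rw [map_add, inner_add_left]
  smul_left f g c := by rw [map_smul, inner_smul_left]
  definite f hf := by
    have h := (re_inner_gam_self (α := α) (β := β) ((toHab α β hα hβ).symm f)).symm.trans
      (congrArg Complex.re hf)
    have h0 : 0 ≤ ‖(toHab α β hα hβ).symm f 0‖ ^ 2 / α := by positivity
    have h1 : 0 ≤ ‖(toHab α β hα hβ).symm f 1‖ ^ 2 / β := by positivity
    rw [Complex.zero_re] at h
    have e0 : ‖(toHab α β hα hβ).symm f 0‖ ^ 2 / α = 0 := by linarith
    have e1 : ‖(toHab α β hα hβ).symm f 1‖ ^ 2 / β = 0 := by linarith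
    apply (toHab α β hα hβ).symm.injective
    rw [map_zero]
    ext1 i
    fin_cases i
    · simpa [hα.ne'] using e0
    · simpa [hβ.ne'] using e1

instance : NormedAddCommGroup (Hab α β hα hβ) := (habCore α β hα hβ).toNormedAddCommGroup

instance : InnerProductSpace ℂ (Hab α β hα hβ) :=
  InnerProductSpace.ofCore (habCore α β hα hβ).toCore

theorem inner_toHab (f g : H) :
    inner ℂ (toHab α β hα hβ f) (toHab α β hα hβ g) = inner ℂ f (gam α β g) := rfl

theorem norm_toHab_sq (f : H) :
    ‖toHab α β hα hβ f‖ ^ 2 = ‖f 0‖ ^ 2 / α + ‖f 1‖ ^ 2 / β := by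
  rw [← re_inner_gam_self, ← inner_toHab (hα := hα) (hβ := hβ)]
  exact (inner_self_eq_norm_sq (𝕜 := ℂ) _).symm

instance : CompleteSpace (Hab α β hα hβ) := by
  have hm : 0 < min (1 / α) (1 / β) := by positivity
  let e : H ≃L[ℂ] Hab α β hα hβ :=
    { toHab α β hα hβ with
      continuous_toFun := by
        refine ((toHab α β hα hβ).toLinearMap.mkContinuous (√(max (1 / α) (1 / β)))
          fun f => ?_).continuous
        refine le_of_sq_le_sq ?_ (by positivity)
        rw [mul_pow, Real.sq_sqrt (by positivity), PiLp.norm_sq_eq_of_L2, Fin.sum_univ_two]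
        refine (norm_toHab_sq f).trans_le ?_
        have h1 := mul_le_mul_of_nonneg_right (le_max_left (1 / α) (1 / β)) (sq_nonneg ‖f 0‖)
        have h2 := mul_le_mul_of_nonneg_right (le_max_right (1 / α) (1 / β)) (sq_nonneg ‖f 1‖)
        rw [one_div_mul_eq_div] at h1 h2
        rw [mul_add]
        exact add_le_add h1 h2
      continuous_invFun := by
        refine ((toHab α β hα hβ).symm.toLinearMap.mkContinuous (√(1 / min (1 / α) (1 / β)))
          fun f => ?_).continuous
        obtain ⟨f, rfl⟩ := (toHab α β hα hβ).surjective f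
        refine le_of_sq_le_sq ?_ (by positivity)
        rw [mul_pow, Real.sq_sqrt (by positivity), norm_toHab_sq, one_div_mul_eq_div,
          le_div_iff₀ hm]
        have h1 := mul_le_mul_of_nonneg_right (min_le_left (1 / α) (1 / β)) (sq_nonneg ‖f 0‖)
        have h2 := mul_le_mul_of_nonneg_right (min_le_right (1 / α) (1 / β)) (sq_nonneg ‖f 1‖)
        rw [one_div_mul_eq_div] at h1 h2
        rw [LinearEquiv.coe_coe, LinearEquiv.symm_apply_apply, PiLp.norm_sq_eq_of_L2,
          Fin.sum_univ_two, mul_comm, mul_add]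
        exact add_le_add h1 h2 }
  exact (completeSpace_congr (e := e.toEquiv) e.isUniformEmbedding).1 inferInstance

end Weighted

/-! ### The intertwining map and the fibers -/

/-- The matrix `c = diag(√α, √β) exp(i (π/4) σ_z)`. -/
def matC (α β : ℝ) : Matrix (Fin 2) (Fin 2) ℂ :=
  !![(√α : ℂ), 0; 0, (√β : ℂ)] * NormedSpace.exp ((Complex.I * (Real.pi / 4 : ℝ)) • sigmaZ)

/-- The map `c ⊗ exp(-i (π/4) a* a)`. -/
def mapI (α β : ℝ) (f : H) : H :=
  matOp (matC α β) (WithLp.toLp 2 fun j => expNum (Real.pi / 4) (f j))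

/-- The two-photon quantum Rabi model with `Δ = (α - β) λ / (2 α β)` and `g = 1 / (2 √(α β))`,
as an operator in the weighted space. -/
def rabiFiber (α β : ℝ) (hα : 0 < α) (hβ : 0 < β) (l : ℝ) :
    Hab α β hα hβ →ₗ.[ℂ] Hab α β hα hβ :=
  conj (toHab α β hα hβ) (rabi ((α - β) / (2 * α * β) * l) (1 / (2 * √(α * β))))

/-- The number `(α + β) λ / (2 α β)`. -/
def fiberValue (α β l : ℝ) : ℂ := (((α + β) / (2 * α * β) * l : ℝ) : ℂ)

/-- The product of `rabiFiber` with the projection, orthogonal in the weighted space, onto its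
eigenspace for the eigenvalue `(α + β) λ / (2 α β)`. -/
def projectedFiber (α β : ℝ) (hα : 0 < α) (hβ : 0 < β) (l : ℝ) :
    Hab α β hα hβ →ₗ.[ℂ] Hab α β hα hβ :=
  pcomp (rabiFiber α β hα hβ l)
    (everywhere (eigenprojection (rabiFiber α β hα hβ l) (fiberValue α β l)).toLinearMap)

/-- The real points of the spectrum of the non-commutative harmonic oscillator. -/
def nchoSpectrum (α β : ℝ) : Set ℝ := {l | (l : ℂ) ∈ spectrum (ncho α β)}

end

end NcHO

/-! Multiplying `Q v = λ v` by the inverse of `diag(α, β)` leaves the oscillator free of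
coefficients and turns the eigenvalue into the matrix `λ diag(1/α, 1/β)`. Its trace part is the
scalar `μ = (α + β) λ / (2αβ)`; its traceless part is `-Δ σ_z`, which moves to the left side as the
Rabi splitting. The rotation `exp(-i (π/4) a* a)` turns `a² - a*²` into `i (a² + a*²)`, and the
phases and moduli in `c` turn the coupling into `g σ_x` with `g = 1 / (2 √(αβ))`. Thus `(H(λ) - μ) I
v = (diag(1/α, 1/β) ⊗ 1) I (Q - λ) v` for every `v` in the domain (`rabi_mapI_zero`,
`rabi_mapI_one`), and hence `E_λ = I ker(Q - λ)` (`eigenspace_rabiFiber`), although the operator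
`H(λ)` varies with `λ`.

The rest is the spectral theorem for `Q`. On `ℂ² ⊗ D(a* a)` it is symmetric, and `Q + c` has a
compact inverse for `c = α + β` (`exists_isCompactResolvent_ncho`): relative to the diagonal
oscillator part, the coupling is an off-diagonal operator `S` with `‖S²‖ ≤ 1/(αβ) < 1`. So the
spectrum consists of real eigenvalues (`mem_spectrum_iff`), the eigenspaces sum to the whole space
(`isHilbertSum`), and the operator is the direct sum of the `λ P_λ` with its exact domain
(`eq_smul_directSum`). On `E_λ` the fiber acts as `μ`, and `2αβ/(α + β)` times `μ` is `λ`.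

All operator domains are read off from Hermite coefficients. This needs the completeness of the
Hermite functions and, as `d/dx` is distributional, the closedness of the graphs of `d/dx` and `x`.
-/

namespace NcHO

/-! ### Spectral theory of symmetric operators with compact resolvent. -/

section CompactResolvent

variable {E : Type*} [NormedAddCommGroup E] [InnerProductSpace ℂ E]

/-- `R` is a compact inverse of `T + c`. -/
structure IsCompactResolvent (T : E →ₗ.[ℂ] E) (c : ℝ) (R : E →L[ℂ] E) : Prop where
  compact : IsCompactOperator R
  right_inv : ∀ y, ∃ h : R y ∈ T.domain, T ⟨R y, h⟩ + (c : ℂ) • R y = y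
  left_inv : ∀ x : T.domain, R (T x + (c : ℂ) • (x : E)) = x

variable {T : E →ₗ.[ℂ] E} {c : ℝ} {R : E →L[ℂ] E}

theorem mem_eigenspace {μ : ℂ} {x : E} :
    x ∈ eigenspace T μ ↔ ∃ hx : x ∈ T.domain, T ⟨x, hx⟩ = μ • x := Iff.rfl

namespace IsCompactResolvent

theorem smul_apply_of_mem_eigenspace (h : IsCompactResolvent T c R) {μ : ℂ} {x : E}
    (hx : x ∈ eigenspace T μ) : (μ + c) • R x = x := by
  obtain ⟨hx, hx'⟩ := hx
  have := h.left_inv ⟨x, hx⟩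
  rw [hx'] at this
  rw [← map_smul, add_smul]
  exact this

theorem eigenspace_neg (h : IsCompactResolvent T c R) : eigenspace T (-c) = ⊥ := by
  rw [eq_bot_iff]
  intro x hx
  have := h.smul_apply_of_mem_eigenspace hx
  rw [neg_add_cancel, zero_smul] at this
  simpa using this.symm

theorem eigenspace_eq (h : IsCompactResolvent T c R) {μ : ℂ} (hμ : μ + c ≠ 0) :
    eigenspace T μ = Module.End.eigenspace (R : E →ₗ[ℂ] E) (μ + c)⁻¹ := by
  ext x
  rw [Module.End.mem_eigenspace_iff, ContinuousLinearMap.coe_coe]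
  constructor
  · intro hx
    rw [eq_inv_smul_iff₀ hμ]
    exact h.smul_apply_of_mem_eigenspace hx
  · intro hx
    obtain ⟨h1, h2⟩ := h.right_inv ((μ + c) • x)
    have h3 : R ((μ + c) • x) = x := by rw [map_smul, hx, smul_inv_smul₀ hμ]
    rw [mem_eigenspace]
    refine ⟨h3 ▸ h1, ?_⟩
    have h4 : T ⟨x, h3 ▸ h1⟩ = T ⟨R ((μ + c) • x), h1⟩ := by congr 2; exact h3.symm
    rw [h4, eq_sub_of_add_eq h2, h3, add_smul, add_sub_cancel_right]

theorem eigenspace_zero (h : IsCompactResolvent T c R) :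
    Module.End.eigenspace (R : E →ₗ[ℂ] E) 0 = ⊥ := by
  rw [eq_bot_iff]
  intro x hx
  rw [Module.End.mem_eigenspace_iff, zero_smul, ContinuousLinearMap.coe_coe] at hx
  obtain ⟨h1, h2⟩ := h.right_inv x
  have h4 : T ⟨R x, h1⟩ = T 0 := by congr 1; exact Subtype.ext hx
  rw [h4, hx, T.map_zero, smul_zero, add_zero] at h2
  exact h2.symm

theorem isClosed_eigenspace (h : IsCompactResolvent T c R) (μ : ℂ) :
    IsClosed (eigenspace T μ : Set E) := by
  by_cases hμ : μ + c = 0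
  · rw [eq_neg_of_add_eq_zero_left hμ, h.eigenspace_neg]
    exact isClosed_singleton
  · have : (eigenspace T μ : Set E) = {x | R x = (μ + c)⁻¹ • x} := by
      rw [h.eigenspace_eq hμ]
      ext x
      exact Module.End.mem_eigenspace_iff
    rw [this]
    exact isClosed_eq R.continuous (continuous_const_smul _)

variable [CompleteSpace E]

/-- The Fredholm alternative for `R` at `(z + c)⁻¹`, carried over to `T`; the point `z = -c` is
separate, `R` itself being the inverse there. -/
theorem mem_spectrum_iff (h : IsCompactResolvent T c R) (z : ℂ) :
    z ∈ spectrum T ↔ eigenspace T z ≠ ⊥ := by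
  constructor
  · intro hz hbot
    apply hz
    by_cases hzc : z + c = 0
    · refine ⟨R, fun y => ?_, fun x => ?_⟩
      · obtain ⟨h1, h2⟩ := h.right_inv y
        refine ⟨h1, ?_⟩
        rw [eq_neg_of_add_eq_zero_left hzc, neg_smul, sub_neg_eq_add, h2]
      · rw [eq_neg_of_add_eq_zero_left hzc, neg_smul, sub_neg_eq_add, h.left_inv]
    have hν : (z + c)⁻¹ ≠ 0 := inv_ne_zero hzc
    have hne : ¬ Module.End.HasEigenvalue (R : E →ₗ[ℂ] E) (z + c)⁻¹ := by
      rw [Module.End.hasEigenvalue_iff, ← h.eigenspace_eq hzc, not_not]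
      exact hbot
    have hres := (h.compact.hasEigenvalue_or_mem_resolventSet hν).resolve_left hne
    obtain ⟨u, hu⟩ := (spectrum.mem_resolventSet_iff).1 hres
    have huapp : ∀ x, (u : E →L[ℂ] E) x = (z + c)⁻¹ • x - R x := fun x => by
      rw [hu]; simp [Algebra.algebraMap_eq_smul_one]
    have hu1 : ∀ x, (u : E →L[ℂ] E) ((↑u⁻¹ : E →L[ℂ] E) x) = x := fun x => by
      rw [← mul_apply_eq_comp, u.mul_inv, one_apply_eq_self]
    have hu2 : ∀ x, (↑u⁻¹ : E →L[ℂ] E) ((u : E →L[ℂ] E) x) = x := fun x => by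
      rw [← mul_apply_eq_comp, u.inv_mul, one_apply_eq_self]
    -- With `u = (z + c)⁻¹ - R` one has `T - z = (z + c) u (T + c)`, which dictates this inverse.
    refine ⟨(z + c)⁻¹ • (R ∘L (↑u⁻¹ : E →L[ℂ] E)), fun y => ?_, fun x => ?_⟩
    · set w := (↑u⁻¹ : E →L[ℂ] E) y with hw
      obtain ⟨h1, h2⟩ := h.right_inv w
      have h3 : ((z + c)⁻¹ • (R ∘L (↑u⁻¹ : E →L[ℂ] E))) y = (z + c)⁻¹ • R w := rfl
      rw [h3]
      refine ⟨T.domain.smul_mem _ h1, ?_⟩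
      have h4 : T ⟨(z + c)⁻¹ • R w, T.domain.smul_mem _ h1⟩ = (z + c)⁻¹ • T ⟨R w, h1⟩ :=
        T.map_smul _ ⟨R w, h1⟩
      have h5 : (z + c)⁻¹ • (z + c) • R w = R w := inv_smul_smul₀ hzc _
      rw [h4, eq_sub_of_add_eq h2, ← hu1 y, huapp, ← hw, sub_eq_iff_eq_add, sub_add_eq_add_sub,
        eq_sub_iff_add_eq]
      nth_rewrite 2 [← h5]
      module
    · set v := T x + (c : ℂ) • (x : E) with hv
      have hx : (x : E) = R v := (h.left_inv x).symm
      have h1 : T x - z • (x : E) = (z + c) • (u : E →L[ℂ] E) v := by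
        rw [huapp, smul_sub, smul_inv_smul₀ hzc, ← hx, hv]
        module
      rw [h1, map_smul]
      change (z + c) • (z + c)⁻¹ • R ((↑u⁻¹ : E →L[ℂ] E) ((u : E →L[ℂ] E) v)) = x
      rw [hu2, smul_inv_smul₀ hzc, hx]
  · rintro hne ⟨V, -, hV⟩
    apply hne
    rw [eq_bot_iff]
    rintro x ⟨hx, hx'⟩
    have := hV ⟨x, hx⟩
    rw [hx', sub_self, map_zero] at this
    exact this.symm

end IsCompactResolvent

theorem inner_eigenspace_apply (hT : T.IsFormalAdjoint T) {μ : ℂ} {e : E}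
    (he : e ∈ eigenspace T μ) (x : T.domain) :
    inner ℂ e (T x) = (starRingEnd ℂ) μ * inner ℂ e (x : E) := by
  obtain ⟨h1, h2⟩ := he
  have := hT ⟨e, h1⟩ x
  rw [h2, inner_smul_left] at this
  exact this.symm

theorem im_eq_zero_of_eigenspace_ne_bot (hT : T.IsFormalAdjoint T) {μ : ℂ}
    (h : eigenspace T μ ≠ ⊥) : μ.im = 0 := by
  obtain ⟨e, he, he0⟩ := Submodule.exists_mem_ne_zero_of_ne_bot h
  obtain ⟨h1, h2⟩ := id he
  have := inner_eigenspace_apply hT he ⟨e, h1⟩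
  rw [h2, inner_smul_right] at this
  have h3 := mul_right_cancel₀ (inner_self_ne_zero.2 he0) this
  exact Complex.conj_eq_iff_im.1 h3.symm

theorem orthogonalFamily_eigenspace (hT : T.IsFormalAdjoint T) (S : Set ℝ) :
    OrthogonalFamily ℂ (fun l : S => eigenspace T (l : ℝ))
      fun l : S => (eigenspace T (l : ℝ)).subtypeₗᵢ := by
  rintro ⟨l, hl⟩ ⟨m, hm⟩ hlm ⟨x, hx⟩ ⟨y, hy⟩
  change inner ℂ x y = 0
  obtain ⟨h1, h2⟩ := id hy
  have := inner_eigenspace_apply hT hx ⟨y, h1⟩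
  rw [h2, inner_smul_right, Complex.conj_ofReal] at this
  by_contra h0
  have h3 := mul_right_cancel₀ h0 this
  exact hlm (Subtype.ext (Complex.ofReal_injective h3.symm))

namespace IsCompactResolvent

variable [CompleteSpace E]

/-- The eigenspaces of the compact symmetric operator `R` have dense span. Those for `ν ≠ 0` are the
eigenspaces of `T` for `ν⁻¹ - c`, and the kernel is zero. Points of `S` that are not eigenvalues
only add zero summands. -/
theorem isHilbertSum (h : IsCompactResolvent T c R) (hT : T.IsFormalAdjoint T) {S : Set ℝ}
    (hS : ∀ l : ℝ, eigenspace T l ≠ ⊥ → l ∈ S) :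
    IsHilbertSum ℂ (fun l : S => eigenspace T (l : ℝ))
      fun l : S => (eigenspace T (l : ℝ)).subtypeₗᵢ := by
  have hcomp : ∀ l : S, CompleteSpace (eigenspace T ((l : ℝ) : ℂ)) := fun l =>
    (h.isClosed_eigenspace _).completeSpace_coe
  refine IsHilbertSum.mkInternal _ (orthogonalFamily_eigenspace hT S) ?_
  have hsymm : (R : E →ₗ[ℂ] E).IsSymmetric := by
    intro x y
    obtain ⟨h1, h2⟩ := h.right_inv x
    obtain ⟨h3, h4⟩ := h.right_inv y
    have := hT ⟨R x, h1⟩ ⟨R y, h3⟩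
    simp only [ContinuousLinearMap.coe_coe]
    conv_lhs => rw [← h4]
    conv_rhs => rw [← h2]
    rw [inner_add_right, inner_add_left, inner_smul_right, inner_smul_left, Complex.conj_ofReal]
    exact congrArg (· + _) this.symm
  have hbot := ContinuousLinearMap.orthogonalComplement_iSup_eigenspaces_eq_bot h.compact hsymm
  rw [top_le_iff, Submodule.topologicalClosure_eq_top_iff, eq_bot_iff, ← hbot]
  refine Submodule.orthogonal_le (iSup_le fun ν => ?_)
  by_cases hν : ν = 0
  · rw [hν, h.eigenspace_zero]; exact bot_le
  have h1 : eigenspace T (ν⁻¹ - c) = Module.End.eigenspace (R : E →ₗ[ℂ] E) ν := by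
    have h1 : ν⁻¹ - c + c = ν⁻¹ := sub_add_cancel _ _
    rw [h.eigenspace_eq (by rw [h1]; exact inv_ne_zero hν), h1, inv_inv]
  rw [← h1]
  by_cases hb : eigenspace T (ν⁻¹ - c) = ⊥
  · rw [hb]; exact bot_le
  have him := im_eq_zero_of_eigenspace_ne_bot hT hb
  have hre : ((ν⁻¹ - c).re : ℂ) = ν⁻¹ - c := by
    apply Complex.ext
    · exact Complex.ofReal_re _
    · rw [Complex.ofReal_im, him]
  rw [← hre] at hb ⊢
  exact le_iSup (fun l : S => eigenspace T (l : ℝ)) ⟨_, hS _ hb⟩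

theorem eigenprojection_mem (h : IsCompactResolvent T c R) (μ : ℂ) (x : E) :
    eigenprojection T μ x ∈ eigenspace T μ := by
  have h1 : eigenprojection T μ x ∈ (eigenspace T μ).topologicalClosure :=
    Submodule.starProjection_apply_mem (eigenspace T μ).topologicalClosure x
  rwa [(h.isClosed_eigenspace μ).submodule_topologicalClosure_eq] at h1

end IsCompactResolvent

theorem inner_eigenprojection [CompleteSpace E] {μ : ℂ} {e : E} (he : e ∈ eigenspace T μ) (x : E) :
    inner ℂ e (eigenprojection T μ x) = inner ℂ e x := by
  have h := Submodule.starProjection_inner_eq_zero (K := (eigenspace T μ).topologicalClosure) x e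
    (Submodule.le_topologicalClosure _ he)
  rw [inner_sub_left, sub_eq_zero] at h
  rw [← inner_conj_symm, ← inner_conj_symm e x, h]
  rfl

/-- A subspace and its closure have the same orthogonal complement, so testing against eigenvectors
suffices and no closedness is needed. -/
theorem eigenprojection_eq [CompleteSpace E] {μ : ℂ} {x p : E} (hp : p ∈ eigenspace T μ)
    (h : ∀ e ∈ eigenspace T μ, inner ℂ e p = inner ℂ e x) : eigenprojection T μ x = p := by
  refine (Submodule.eq_starProjection_of_mem_orthogonal
    (Submodule.le_topologicalClosure _ hp) ?_)
  rw [Submodule.orthogonal_closure]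
  intro e he
  rw [inner_sub_right, h e he, sub_self]

namespace IsCompactResolvent

variable [CompleteSpace E]

theorem hasSum_eigenprojection (h : IsCompactResolvent T c R) (hT : T.IsFormalAdjoint T)
    {S : Set ℝ} (hS : ∀ l : ℝ, eigenspace T l ≠ ⊥ → l ∈ S) (x : E) :
    HasSum (fun l : S => eigenprojection T (l : ℝ) x) x := by
  have hH := h.isHilbertSum hT hS
  obtain ⟨w, rfl⟩ := hH.surjective_isometry x
  have h1 := hH.OrthogonalFamily.hasSum_linearIsometry w
  refine h1.congr_fun fun l => eigenprojection_eq (w l).2 fun e he => ?_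
  refine (hasSum_single l fun m hm => ?_).unique (h1.mapL (innerSL ℂ e))
  exact hH.OrthogonalFamily hm.symm ⟨e, he⟩ (w m)

theorem eigenprojection_apply (h : IsCompactResolvent T c R) (hT : T.IsFormalAdjoint T) (l : ℝ)
    (x : T.domain) : eigenprojection T l (T x) = (l : ℂ) • eigenprojection T l (x : E) := by
  refine eigenprojection_eq (Submodule.smul_mem _ _ (h.eigenprojection_mem _ _)) fun e he => ?_
  rw [inner_smul_right, inner_eigenprojection he, inner_eigenspace_apply hT he, Complex.conj_ofReal]

/-- Projecting `T x` onto the eigenspaces gives the values and one inclusion of domains; the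
resolvent gives the other. -/
theorem eq_smul_directSum (h : IsCompactResolvent T c R) (hT : T.IsFormalAdjoint T) {S : Set ℝ}
    (hS : ∀ l : ℝ, eigenspace T l ≠ ⊥ → l ∈ S) {A : S → E →ₗ.[ℂ] E} {k : ℂ} (hk : k ≠ 0)
    (hA : ∀ i x, ∃ hx : x ∈ (A i).domain,
      k • A i ⟨x, hx⟩ = ((i : ℝ) : ℂ) • eigenprojection T (i : ℝ) x) :
    T = k • directSum A := by
  choose hd hv using hA
  have hsum := h.hasSum_eigenprojection hT hS
  have key : ∀ x : T.domain, HasSum (fun i : S => A i ⟨x, hd i x⟩) (k⁻¹ • T x) := by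
    intro x
    refine ((hsum (T x)).const_smul k⁻¹).congr_fun ?_
    intro i
    rw [h.eigenprojection_apply hT, ← hv i x, inv_smul_smul₀ hk]
  have hdom : ∀ x, x ∈ T.domain ↔ x ∈ (directSum A).domain := by
    intro x
    constructor
    · intro hx
      exact ⟨fun i => hd i x, (key ⟨x, hx⟩).summable⟩
    · rintro ⟨h1, h2⟩
      obtain ⟨y, hy⟩ := h2
      -- Termwise `R` sends `(l + c) P_l x` to `P_l x`, so summation gives `R (k y + c x) = x`. Thus
      -- `x` lies in the range of `R`, which is inside the domain of `T`.
      have h3 := ((hy.const_smul k).add ((hsum x).const_smul (c : ℂ))).mapL R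
      have h4 : (fun i : S => R (k • A i ⟨x, h1 i⟩ + (c : ℂ) • eigenprojection T (i : ℝ) x)) =
          fun i : S => eigenprojection T (i : ℝ) x := by
        funext i
        rw [hv i x, ← add_smul, map_smul]
        exact h.smul_apply_of_mem_eigenspace (h.eigenprojection_mem _ x)
      have h5 := (h4 ▸ h3).unique (hsum x)
      rw [← h5]
      exact (h.right_inv _).1
  refine LinearPMap.ext (Submodule.ext hdom) fun x hx hx' => ?_
  have h1 : (k • directSum A) ⟨x, hx'⟩ = k • ∑' i, A i ⟨x, hd i x⟩ := rfl
  rw [h1, (key ⟨x, hx⟩).tsum_eq, smul_inv_smul₀ hk]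

end IsCompactResolvent
end CompactResolvent

/-! ### Hermite functions and ladder operators on the Schwartz space. -/

section Hermite

open Real Polynomial
open scoped Nat FourierTransform ContDiff

theorem abs_pow_mul_exp_neg_sq_le (k : ℕ) (x : ℝ) :
    |x| ^ k * rexp (-(x ^ 2 / 2)) ≤ k ! * rexp (1 / 2) := by
  have h1 := Real.pow_div_factorial_le_exp |x| (abs_nonneg x) k
  rw [div_le_iff₀ (by positivity)] at h1
  calc |x| ^ k * rexp (-(x ^ 2 / 2)) ≤ (rexp |x| * k !) * rexp (-(x ^ 2 / 2)) := by gcongr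
    _ = k ! * rexp (|x| + -(x ^ 2 / 2)) := by rw [Real.exp_add]; ring
    _ ≤ k ! * rexp (1 / 2) := by
      gcongr
      nlinarith [sq_nonneg (|x| - 1), sq_abs x]

/-- Meant for `p = hermite n`: up to sign, the `n`-th derivative of the Gaussian is `hermite n`
times the Gaussian, so this is its Schwartz decay. -/
theorem exists_abs_pow_mul_aeval_mul_exp_le (k : ℕ) (p : ℤ[X]) :
    ∃ C, ∀ x : ℝ, |x| ^ k * |aeval x p * rexp (-(x ^ 2 / 2))| ≤ C := by
  induction p using Polynomial.induction_on' with
  | add p q hp hq =>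
    obtain ⟨C, hC⟩ := hp
    obtain ⟨D, hD⟩ := hq
    refine ⟨C + D, fun x => ?_⟩
    rw [map_add, add_mul]
    calc _ ≤ |x| ^ k * (|aeval x p * rexp (-(x ^ 2 / 2))| + |aeval x q * rexp (-(x ^ 2 / 2))|) := by
          gcongr; exact abs_add_le _ _
      _ ≤ C + D := by rw [mul_add]; exact add_le_add (hC x) (hD x)
  | monomial n a =>
    refine ⟨|(a : ℝ)| * ((k + n)! * rexp (1 / 2)), fun x => ?_⟩
    rw [aeval_monomial, abs_mul, abs_mul, abs_pow, Real.abs_exp]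
    calc _ = |(a : ℝ)| * (|x| ^ (k + n) * rexp (-(x ^ 2 / 2))) := by
          simp only [algebraMap_int_eq, eq_intCast]; ring
      _ ≤ _ := mul_le_mul_of_nonneg_left (abs_pow_mul_exp_neg_sq_le _ _) (abs_nonneg _)

/-- The Gaussian `exp (-x² / 2)` as a Schwartz function. -/
noncomputable def gaussian : 𝓢(ℝ, ℂ) where
  toFun x := (rexp (-(x ^ 2 / 2)) : ℂ)
  smooth' := by
    have : ContDiff ℝ ∞ fun x : ℝ => rexp (-(x ^ 2 / 2)) := by fun_prop
    exact Complex.ofRealCLM.contDiff.comp this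
  decay' k n := by
    have hc : ContDiff ℝ n fun x : ℝ => rexp (-(x ^ 2 / 2)) := by fun_prop
    obtain ⟨C, hC⟩ := exists_abs_pow_mul_aeval_mul_exp_le k (hermite n)
    refine ⟨C, fun x => le_trans (le_of_eq ?_) (hC x)⟩
    have h1 := Complex.ofRealLI.norm_iteratedFDeriv_comp_left (f := fun x : ℝ => rexp (-(x ^ 2 / 2)))
      (x := x) hc.contDiffAt le_rfl
    have h2 : (Complex.ofRealLI ∘ fun x : ℝ => rexp (-(x ^ 2 / 2))) =
      fun x => (rexp (-(x ^ 2 / 2)) : ℂ) := rfl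
    rw [h2] at h1
    rw [h1, norm_iteratedFDeriv_eq_norm_iteratedDeriv, iteratedDeriv_eq_iterate,
      deriv_gaussian_eq_hermite_mul_gaussian, mul_assoc, Real.norm_eq_abs, Real.norm_eq_abs,
      abs_mul, abs_pow, abs_neg, abs_one, one_pow, one_mul]

theorem gaussian_apply (x : ℝ) : gaussian x = (rexp (-(x ^ 2 / 2)) : ℂ) := rfl

/-- Differentiation of Schwartz functions. -/
noncomputable abbrev derivS : 𝓢(ℝ, ℂ) →L[ℂ] 𝓢(ℝ, ℂ) := SchwartzMap.derivCLM ℂ ℂ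

/-- Multiplication of Schwartz functions by `x`. -/
noncomputable def posS : 𝓢(ℝ, ℂ) →L[ℂ] 𝓢(ℝ, ℂ) := SchwartzMap.smulLeftCLM ℂ Complex.ofReal

theorem posS_apply (f : 𝓢(ℝ, ℂ)) (x : ℝ) : posS f x = x * f x := by
  rw [posS, SchwartzMap.smulLeftCLM_apply_apply (by fun_prop), smul_eq_mul]

/-- The annihilation operator on Schwartz functions. -/
noncomputable def annS : 𝓢(ℝ, ℂ) →L[ℂ] 𝓢(ℝ, ℂ) := ((1 / √2 : ℝ) : ℂ) • (derivS + posS)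

/-- The creation operator on Schwartz functions. -/
noncomputable def creS : 𝓢(ℝ, ℂ) →L[ℂ] 𝓢(ℝ, ℂ) := ((1 / √2 : ℝ) : ℂ) • (-derivS + posS)

theorem one_div_sqrt_two_mul_self : ((1 / √2 : ℝ) : ℂ) * ((1 / √2 : ℝ) : ℂ) = 1 / 2 := by
  rw [← Complex.ofReal_mul, div_mul_div_comm, one_mul, Real.mul_self_sqrt (by norm_num)]
  norm_num

theorem annS_add_creS (f : 𝓢(ℝ, ℂ)) : annS f + creS f = ((2 * (1 / √2) : ℝ) : ℂ) • posS f := by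
  simp only [annS, creS, smul_apply, add_apply,
    neg_apply]
  push_cast
  module

theorem posS_eq (f : 𝓢(ℝ, ℂ)) : posS f = ((1 / √2 : ℝ) : ℂ) • (annS f + creS f) := by
  rw [annS_add_creS, smul_smul]
  push_cast
  have := one_div_sqrt_two_mul_self
  push_cast at this
  rw [mul_left_comm, this]
  norm_num

theorem derivS_eq (f : 𝓢(ℝ, ℂ)) : derivS f = ((1 / √2 : ℝ) : ℂ) • (annS f - creS f) := by
  have h : ((1 / √2 : ℝ) : ℂ) • ((1 / √2 : ℝ) : ℂ) • ((2 : ℂ) • derivS f) = derivS f := by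
    rw [smul_smul, smul_smul, one_div_sqrt_two_mul_self]
    norm_num
  rw [← h]
  simp only [annS, creS, smul_apply, add_apply, neg_apply]
  module

theorem derivS_posS (f : 𝓢(ℝ, ℂ)) : derivS (posS f) = posS (derivS f) + f := by
  ext x
  have h1 : (posS f : ℝ → ℂ) = fun x : ℝ => (x : ℂ) * f x := funext (posS_apply f)
  rw [add_apply, posS_apply, SchwartzMap.derivCLM_apply, SchwartzMap.derivCLM_apply, h1]
  have h2 : HasDerivAt (fun x : ℝ => (x : ℂ)) 1 x := Complex.ofRealCLM.hasDerivAt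
  rw [(h2.fun_mul (f.hasDerivAt x)).deriv]
  ring

theorem annS_creS (f : 𝓢(ℝ, ℂ)) : annS (creS f) = creS (annS f) + f := by
  have h : ((1 / √2 : ℝ) : ℂ) • ((1 / √2 : ℝ) : ℂ) • (f + f) = f := by
    rw [smul_smul, one_div_sqrt_two_mul_self]
    module
  simp only [annS, creS, smul_apply, add_apply,
    neg_apply, map_add, map_smul, map_neg, derivS_posS]
  conv_rhs => arg 2; rw [← h]
  module

theorem annS_gaussian : annS gaussian = 0 := by
  ext x
  have h1 : HasDerivAt (fun x : ℝ => rexp (-(x ^ 2 / 2))) (rexp (-(x ^ 2 / 2)) * -x) x := by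
    convert ((((hasDerivAt_id' x).fun_pow 2).div_const 2).fun_neg).exp using 2
    simp
  have h2 : deriv gaussian x = (rexp (-(x ^ 2 / 2)) * -x : ℝ) := h1.ofReal_comp.deriv
  simp only [annS, smul_apply, add_apply, SchwartzMap.derivCLM_apply, posS_apply, h2,
    gaussian_apply, zero_apply]
  push_cast
  simp only [smul_eq_mul]
  ring

/-- The normalized Hermite functions, as Schwartz functions. -/
noncomputable def hermiteS : ℕ → 𝓢(ℝ, ℂ)
  | 0 => ((√(√π))⁻¹ : ℝ) • gaussian
  | n + 1 => ((√(n + 1 : ℝ))⁻¹ : ℝ) • creS (hermiteS n)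

theorem creS_hermiteS (n : ℕ) : creS (hermiteS n) = (√(n + 1 : ℝ) : ℂ) • hermiteS (n + 1) := by
  rw [hermiteS, ← Complex.coe_smul (√(n + 1 : ℝ))⁻¹, smul_smul, ← Complex.ofReal_mul,
    mul_inv_cancel₀ (by positivity), Complex.ofReal_one, one_smul]

theorem annS_hermiteS_zero : annS (hermiteS 0) = 0 := by
  rw [hermiteS, ← Complex.coe_smul, map_smul, annS_gaussian, smul_zero]

/-- The commutation relation gives `a a* h_n = (n + 1) h_n` by induction; the normalization of
`h_(n+1)` then leaves `√(n + 1)`. -/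
theorem annS_hermiteS_succ (n : ℕ) :
    annS (hermiteS (n + 1)) = (√(n + 1 : ℝ) : ℂ) • hermiteS n := by
  have key : ∀ n : ℕ, annS (creS (hermiteS n)) = ((n + 1 : ℝ) : ℂ) • hermiteS n := by
    intro n
    induction n with
    | zero => rw [annS_creS, annS_hermiteS_zero, map_zero]; simp
    | succ n ih =>
      have h : creS (annS (hermiteS (n + 1))) = ((n + 1 : ℝ) : ℂ) • hermiteS (n + 1) := by
        rw [hermiteS, ← Complex.coe_smul, map_smul, ih, map_smul, map_smul, smul_comm]
      rw [annS_creS, h]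
      push_cast
      module
  rw [hermiteS, ← Complex.coe_smul, map_smul, key, smul_smul, ← Complex.ofReal_mul]
  congr 2
  rw [inv_mul_eq_iff_eq_mul₀ (by positivity), Real.mul_self_sqrt (by positivity)]

/-- A Schwartz function with real values. -/
def IsRealValued (f : 𝓢(ℝ, ℂ)) : Prop := ∀ x, (starRingEnd ℂ) (f x) = f x

theorem IsRealValued.derivS {f : 𝓢(ℝ, ℂ)} (hf : IsRealValued f) : IsRealValued (derivS f) := by
  intro x
  rw [SchwartzMap.derivCLM_apply]
  have h := (f.hasDerivAt x).star
  have h1 : (fun x => star (f x)) = f := funext hf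
  rw [h1] at h
  exact h.unique (f.hasDerivAt x)

theorem IsRealValued.posS {f : 𝓢(ℝ, ℂ)} (hf : IsRealValued f) : IsRealValued (posS f) := by
  intro x
  rw [posS_apply, map_mul, hf x, Complex.conj_ofReal]

theorem isRealValued_hermiteS (n : ℕ) : IsRealValued (hermiteS n) := by
  induction n with
  | zero =>
    intro x
    simp only [hermiteS, gaussian_apply, smul_apply, Complex.real_smul, map_mul,
      Complex.conj_ofReal]
  | succ n ih =>
    intro x
    simp only [hermiteS, creS, smul_apply, add_apply,
      neg_apply, Complex.real_smul, smul_eq_mul, map_mul, map_add, map_neg,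
      Complex.conj_ofReal, ih.derivS x, ih.posS x]

theorem posS_iterate_gaussian_apply (k : ℕ) (x : ℝ) :
    (posS^[k] gaussian) x = (x : ℂ) ^ k * gaussian x := by
  induction k with
  | zero => simp
  | succ k ih => rw [Function.iterate_succ_apply', posS_apply, ih, pow_succ']; ring

/-- Since `x = (a + a*) / √2`, multiplication by `x` preserves the span of the Hermite functions. -/
theorem posS_iterate_gaussian_mem_span (k : ℕ) :
    posS^[k] gaussian ∈ Submodule.span ℂ (Set.range hermiteS) := by
  have hmem : ∀ n, hermiteS n ∈ Submodule.span ℂ (Set.range hermiteS) := fun n =>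
    Submodule.subset_span ⟨n, rfl⟩
  induction k with
  | zero =>
    have h : gaussian = (√(√π) : ℂ) • hermiteS 0 := by
      rw [hermiteS, ← Complex.coe_smul, smul_smul, ← Complex.ofReal_mul,
        mul_inv_cancel₀ (by positivity), Complex.ofReal_one, one_smul]
    rw [Function.iterate_zero, id, h]
    exact Submodule.smul_mem _ _ (hmem 0)
  | succ k ih =>
    rw [Function.iterate_succ_apply']
    have h : Submodule.span ℂ (Set.range hermiteS) ≤
        (Submodule.span ℂ (Set.range hermiteS)).comap (posS : 𝓢(ℝ, ℂ) →ₗ[ℂ] 𝓢(ℝ, ℂ)) := by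
      rw [Submodule.span_le]
      rintro _ ⟨n, rfl⟩
      change posS (hermiteS n) ∈ Submodule.span ℂ (Set.range hermiteS)
      rw [posS_eq, creS_hermiteS]
      refine Submodule.smul_mem _ _ (Submodule.add_mem _ ?_ (Submodule.smul_mem _ _ (hmem _)))
      cases n with
      | zero => rw [annS_hermiteS_zero]; exact Submodule.zero_mem _
      | succ n => rw [annS_hermiteS_succ]; exact Submodule.smul_mem _ _ (hmem _)
    exact h ih

end Hermite

/-! ### Ladder operators in `L²(ℝ)` and orthonormality. -/

section HermiteBasis

open Real
open scoped FourierTransform ContDiff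

/-- The embedding of the Schwartz space into `L²(ℝ)`. -/
noncomputable def toL2 : 𝓢(ℝ, ℂ) →L[ℂ] L2 := SchwartzMap.toLpCLM ℂ ℂ 2 volume

theorem coeFn_toL2 (f : 𝓢(ℝ, ℂ)) : toL2 f =ᵐ[volume] f := f.coeFn_toLp 2 volume

theorem toL2_mem_derivGraph (f : 𝓢(ℝ, ℂ)) : (toL2 f, toL2 (derivS f)) ∈ derivGraph := by
  rw [mem_derivGraph_iff]
  have h (f : 𝓢(ℝ, ℂ)) : ((toL2 f : L2) : 𝓢'(ℝ, ℂ)) = f :=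
    Lp.toTemperedDistribution_toLp_eq f
  rw [h, h, TemperedDistribution.derivCLM_toTemperedDistributionCLM_eq (𝕜 := ℂ)]

theorem mem_posGraph_iff (f g : L2) : (f, g) ∈ posGraph ↔ ∀ᵐ x : ℝ, g x = (x : ℂ) * f x := Iff.rfl

theorem toL2_mem_posGraph (f : 𝓢(ℝ, ℂ)) : (toL2 f, toL2 (posS f)) ∈ posGraph := by
  rw [mem_posGraph_iff]
  filter_upwards [coeFn_toL2 f, coeFn_toL2 (posS f)] with x h1 h2
  rw [h1, h2, posS_apply]

/-- Distributions pair bilinearly, the inner product sesquilinearly; they agree on real test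
functions, and the Hermite functions are real. -/
theorem inner_toL2 {φ : 𝓢(ℝ, ℂ)} (hφ : IsRealValued φ) (f : L2) :
    inner ℂ (toL2 φ) f = ∫ x, φ x * f x := by
  rw [L2.inner_def]
  refine integral_congr_ae ?_
  filter_upwards [coeFn_toL2 φ] with x h1
  rw [RCLike.inner_apply, h1, hφ x, mul_comm]

theorem inner_toL2_of_mem_derivGraph {φ : 𝓢(ℝ, ℂ)} (hφ : IsRealValued φ) {f g : L2}
    (h : (f, g) ∈ derivGraph) : inner ℂ (toL2 φ) g = -inner ℂ (toL2 (derivS φ)) f := by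
  rw [mem_derivGraph_iff] at h
  have h1 := DFunLike.congr_fun h φ
  rw [TemperedDistribution.derivCLM_apply_apply, map_neg, Lp.toTemperedDistribution_apply,
    Lp.toTemperedDistribution_apply] at h1
  rw [inner_toL2 hφ, inner_toL2 hφ.derivS]
  exact h1.symm

theorem inner_toL2_of_mem_posGraph {φ : 𝓢(ℝ, ℂ)} (hφ : IsRealValued φ) {f g : L2}
    (h : (f, g) ∈ posGraph) : inner ℂ (toL2 φ) g = inner ℂ (toL2 (posS φ)) f := by
  rw [mem_posGraph_iff] at h
  rw [inner_toL2 hφ, inner_toL2 hφ.posS]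
  refine integral_congr_ae ?_
  filter_upwards [h] with x h1
  rw [h1, posS_apply]
  ring

theorem isClosed_derivGraph : IsClosed (derivGraph : Set (L2 × L2)) := by
  have h : (derivGraph : Set (L2 × L2)) = {p | TemperedDistribution.derivCLM ℂ
      (Lp.toTemperedDistributionCLM ℂ (volume : Measure ℝ) 2 p.1) =
        Lp.toTemperedDistributionCLM ℂ (volume : Measure ℝ) 2 p.2} := by
    ext ⟨f, g⟩
    exact mem_derivGraph_iff f g
  rw [h]
  exact isClosed_eq (by fun_prop) (by fun_prop)

/-- Convergence in `L²` gives almost everywhere convergence along a subsequence; a second extraction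
serves both components, and the pointwise relation passes to the limit. -/
theorem isClosed_posGraph : IsClosed (posGraph : Set (L2 × L2)) := by
  refine IsSeqClosed.isClosed ?_
  rintro u ⟨f, g⟩ hu hlim
  have h1 : Filter.Tendsto (fun n => (u n).1) .atTop (nhds f) := hlim.fst_nhds
  have h2 : Filter.Tendsto (fun n => (u n).2) .atTop (nhds g) := hlim.snd_nhds
  obtain ⟨ns, hns, h3⟩ := (tendstoInMeasure_of_tendsto_Lp h1).exists_seq_tendsto_ae
  obtain ⟨ms, hms, h4⟩ := (tendstoInMeasure_of_tendsto_Lp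
    (h2.comp hns.tendsto_atTop)).exists_seq_tendsto_ae
  have h5 : ∀ᵐ x : ℝ, ∀ n, (u n).2 x = (x : ℂ) * (u n).1 x := ae_all_iff.2 hu
  change ∀ᵐ x : ℝ, g x = (x : ℂ) * f x
  filter_upwards [h3, h4, h5] with x h3 h4 h5
  refine tendsto_nhds_unique h4 ?_
  have h6 := (h3.comp hms.tendsto_atTop).const_mul (x : ℂ)
  refine h6.congr fun n => ?_
  exact (h5 _).symm

/-- The domains of `ann` and `cre` are by definition the same intersection `D(d/dx) ∩ D(x)`. Later
proofs use one for the other without comment. -/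
theorem mem_ladder_of_mem_graphs {f g₁ g₂ : L2} (h₁ : (f, g₁) ∈ derivGraph)
    (h₂ : (f, g₂) ∈ posGraph) :
    (∃ h : f ∈ ann.domain, ann ⟨f, h⟩ = ((1 / √2 : ℝ) : ℂ) • (g₁ + g₂)) ∧
      ∃ h : f ∈ cre.domain, cre ⟨f, h⟩ = ((1 / √2 : ℝ) : ℂ) • (-g₁ + g₂) := by
  rw [← derivOp_graph, LinearPMap.mem_graph_iff] at h₁
  rw [← posOp_graph, LinearPMap.mem_graph_iff] at h₂
  obtain ⟨⟨x, hx⟩, rfl, rfl⟩ := h₁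
  obtain ⟨⟨y, hy⟩, h, rfl⟩ := h₂
  obtain rfl : y = x := h
  exact ⟨⟨⟨hx, hy⟩, rfl⟩, ⟨⟨hx, hy⟩, rfl⟩⟩

theorem exists_mem_graphs_of_mem_ann {f : L2} (h : f ∈ ann.domain) :
    ∃ g₁ g₂, (f, g₁) ∈ derivGraph ∧ (f, g₂) ∈ posGraph := by
  rw [← derivOp_graph, ← posOp_graph]
  exact ⟨_, _, derivOp.mem_graph ⟨f, h.1⟩, posOp.mem_graph ⟨f, h.2⟩⟩

theorem toL2_mem_ladder (f : 𝓢(ℝ, ℂ)) :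
    (∃ h : toL2 f ∈ ann.domain, ann ⟨toL2 f, h⟩ = toL2 (annS f)) ∧
      ∃ h : toL2 f ∈ cre.domain, cre ⟨toL2 f, h⟩ = toL2 (creS f) := by
  have h := mem_ladder_of_mem_graphs (toL2_mem_derivGraph f) (toL2_mem_posGraph f)
  simpa only [annS, creS, smul_apply, add_apply, neg_apply, map_smul, map_add, map_neg] using h

theorem inner_toL2_ann {φ : 𝓢(ℝ, ℂ)} (hφ : IsRealValued φ) (f : ann.domain) :
    inner ℂ (toL2 φ) (ann f) = inner ℂ (toL2 (creS φ)) (f : L2) := by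
  obtain ⟨f, hf⟩ := f
  obtain ⟨g₁, g₂, h₁, h₂⟩ := exists_mem_graphs_of_mem_ann hf
  obtain ⟨⟨_, h⟩, -⟩ := mem_ladder_of_mem_graphs h₁ h₂
  rw [h, inner_smul_right, inner_add_right, inner_toL2_of_mem_derivGraph hφ h₁,
    inner_toL2_of_mem_posGraph hφ h₂]
  simp only [creS, smul_apply, add_apply, neg_apply, map_smul, map_add, map_neg, inner_smul_left,
    inner_add_left, inner_neg_left, Complex.conj_ofReal]

theorem inner_toL2_cre {φ : 𝓢(ℝ, ℂ)} (hφ : IsRealValued φ) (f : cre.domain) :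
    inner ℂ (toL2 φ) (cre f) = inner ℂ (toL2 (annS φ)) (f : L2) := by
  obtain ⟨f, hf⟩ := f
  obtain ⟨g₁, g₂, h₁, h₂⟩ := exists_mem_graphs_of_mem_ann hf
  obtain ⟨-, _, h⟩ := mem_ladder_of_mem_graphs h₁ h₂
  rw [h, inner_smul_right, inner_add_right, inner_neg_right, inner_toL2_of_mem_derivGraph hφ h₁,
    inner_toL2_of_mem_posGraph hφ h₂, neg_neg]
  simp only [annS, smul_apply, add_apply, map_smul, map_add, inner_smul_left,
    inner_add_left, Complex.conj_ofReal]

/-- The normalized Hermite functions in `L²(ℝ)`. -/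
noncomputable def hermiteL (n : ℕ) : L2 := toL2 (hermiteS n)

theorem inner_hermiteL_ann (n : ℕ) (f : ann.domain) :
    inner ℂ (hermiteL n) (ann f) = √(n + 1 : ℝ) * inner ℂ (hermiteL (n + 1)) (f : L2) := by
  rw [hermiteL, inner_toL2_ann (isRealValued_hermiteS n), creS_hermiteS, map_smul, inner_smul_left,
    Complex.conj_ofReal, hermiteL]

theorem inner_hermiteL_zero_cre (f : cre.domain) : inner ℂ (hermiteL 0) (cre f) = 0 := by
  rw [hermiteL, inner_toL2_cre (isRealValued_hermiteS 0), annS_hermiteS_zero, map_zero,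
    inner_zero_left]

theorem inner_hermiteL_succ_cre (n : ℕ) (f : cre.domain) :
    inner ℂ (hermiteL (n + 1)) (cre f) = √(n + 1 : ℝ) * inner ℂ (hermiteL n) (f : L2) := by
  rw [hermiteL, inner_toL2_cre (isRealValued_hermiteS _), annS_hermiteS_succ, map_smul,
    inner_smul_left, Complex.conj_ofReal, hermiteL]

/-- The squared Gaussian `exp(-x²)` has integral `√π`, whence the constant in `hermiteS 0`. -/
theorem inner_hermiteL_zero_zero : inner ℂ (hermiteL 0) (hermiteL 0) = 1 := by
  rw [hermiteL, inner_toL2 (isRealValued_hermiteS 0)]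
  have h : ∀ᵐ x : ℝ, hermiteS 0 x * (toL2 (hermiteS 0) : ℝ → ℂ) x =
      (((√π)⁻¹ * rexp (-1 * x ^ 2) : ℝ) : ℂ) := by
    filter_upwards [coeFn_toL2 (hermiteS 0)] with x hx
    have h1 : hermiteS 0 x = ((√(√π))⁻¹ * rexp (-(x ^ 2 / 2)) : ℝ) := by
      rw [hermiteS, smul_apply, gaussian_apply, Complex.real_smul, Complex.ofReal_mul]
    rw [hx, h1, ← Complex.ofReal_mul, mul_mul_mul_comm, ← mul_inv,
      Real.mul_self_sqrt (by positivity), ← Real.exp_add]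
    congr 4
    ring
  rw [integral_congr_ae h, integral_complex_ofReal, integral_const_mul, integral_gaussian, div_one,
    inv_mul_cancel₀ (by positivity), Complex.ofReal_one]

theorem inner_hermiteL_zero_succ (n : ℕ) : inner ℂ (hermiteL 0) (hermiteL (n + 1)) = 0 := by
  obtain ⟨-, h, h'⟩ := toL2_mem_ladder (hermiteS n)
  have h1 := inner_hermiteL_zero_cre ⟨_, h⟩
  rw [h', creS_hermiteS, map_smul, inner_smul_right] at h1
  refine (mul_eq_zero.1 h1).resolve_left ?_
  exact Complex.ofReal_ne_zero.2 (by positivity)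

/-- Moving `a*` across the inner product lowers both indices at once: `√(n + 1) ⟨h_(m+1), h_(n+1)⟩ =
√(m + 1) ⟨h_m, h_n⟩`. -/
theorem inner_hermiteL (m n : ℕ) : inner ℂ (hermiteL m) (hermiteL n) = if m = n then 1 else 0 := by
  induction m generalizing n with
  | zero =>
    cases n with
    | zero => simpa using inner_hermiteL_zero_zero
    | succ n => simpa using inner_hermiteL_zero_succ n
  | succ m ih =>
    cases n with
    | zero => rw [← inner_conj_symm, inner_hermiteL_zero_succ]; simp
    | succ n =>
      obtain ⟨-, h, h'⟩ := toL2_mem_ladder (hermiteS n)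
      have h1 := inner_hermiteL_succ_cre m ⟨_, h⟩
      have h2 : inner ℂ (hermiteL m) (toL2 (hermiteS n)) = if m = n then 1 else 0 := ih n
      rw [h', creS_hermiteS, map_smul, inner_smul_right, h2] at h1
      have h3 : (√(n + 1 : ℝ) : ℂ) ≠ 0 := Complex.ofReal_ne_zero.2 (by positivity)
      by_cases hmn : m = n
      · subst hmn
        rw [if_pos rfl] at h1 ⊢
        exact mul_left_cancel₀ h3 h1
      · rw [if_neg hmn, mul_zero] at h1
        rw [if_neg (by omega)]
        exact (mul_eq_zero.1 h1).resolve_left h3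

theorem orthonormal_hermiteL : Orthonormal ℂ hermiteL :=
  orthonormal_iff_ite.2 inner_hermiteL

end HermiteBasis

/-! ### Completeness of the Hermite functions. -/

section HermiteComplete

open Real
open scoped FourierTransform ContDiff

/-- An integrable function with vanishing Fourier transform vanishes almost everywhere. -/
theorem ae_eq_zero_of_fourier_eq_zero {g : ℝ → ℂ} (hg : Integrable g) (h : 𝓕 g = 0) :
    ∀ᵐ x, g x = 0 := by
  -- Write `ψ` as the Fourier transform of its inverse transform and move the transform onto `g`.
  have key : ∀ ψ : 𝓢(ℝ, ℂ), ∫ x, ψ x * g x = 0 := by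
    intro ψ
    have h1 := VectorFourier.integral_fourierIntegral_smul_eq_flip (L := innerₗ ℝ)
      (f := (𝓕⁻ ψ : 𝓢(ℝ, ℂ))) (g := g) (μ := volume) (ν := volume) continuous_fourierChar
      continuous_inner (𝓕⁻ ψ : 𝓢(ℝ, ℂ)).integrable hg
    have h2 : VectorFourier.fourierIntegral 𝐞 volume (innerₗ ℝ) (𝓕⁻ ψ : 𝓢(ℝ, ℂ)) = ψ := by
      have h3 : 𝓕 (𝓕⁻ ψ) = ψ := FourierTransform.fourier_fourierInv_eq ψ
      exact congrArg (fun φ : 𝓢(ℝ, ℂ) => (φ : ℝ → ℂ)) h3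
    have h4 : VectorFourier.fourierIntegral 𝐞 volume (innerₗ ℝ).flip g = 0 := by
      rw [flip_innerₗ]; exact h
    rw [h2, h4] at h1
    simpa using h1
  refine ae_eq_zero_of_integral_contDiff_smul_eq_zero hg.locallyIntegrable ?_
  intro ψ hψ hc
  have hc' : HasCompactSupport (Complex.ofRealCLM ∘ ψ) := hc.comp_left rfl
  have hψ' : ContDiff ℝ ∞ (Complex.ofRealCLM ∘ ψ) := by fun_prop
  have := key (hc'.toSchwartzMap hψ')
  simpa using this

/-- The dominating function for the exponential series: `exp(|t x| - x²/2)` is square integrable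
because `2|t x| ≤ 2t² + x²/2`. -/
theorem integrable_exp_mul_abs_mul_gaussian_mul (t : ℝ) (f : L2) :
    Integrable fun x : ℝ => rexp (|t * x|) * (rexp (-(x ^ 2 / 2)) * ‖f x‖) := by
  have hf : MemLp (fun x => ‖f x‖) 2 (volume : Measure ℝ) := (Lp.memLp f).norm
  have hcont : Continuous fun x : ℝ => rexp (|t * x|) * rexp (-(x ^ 2 / 2)) := by fun_prop
  have hg : MemLp (fun x : ℝ => rexp (|t * x|) * rexp (-(x ^ 2 / 2))) 2 (volume : Measure ℝ) := by
    rw [memLp_two_iff_integrable_sq hcont.aestronglyMeasurable]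
    have h1 := (integrable_exp_neg_mul_sq (b := 1 / 2) (by norm_num)).const_mul (rexp (2 * t ^ 2))
    refine h1.mono' (by fun_prop) (Filter.Eventually.of_forall fun x => ?_)
    rw [Real.norm_eq_abs, abs_of_nonneg (by positivity), ← Real.exp_add, ← Real.exp_add, sq,
      ← Real.exp_add]
    refine Real.exp_le_exp.2 ?_
    have h2 := sq_nonneg (|t| * 2 - |x|)
    have h3 := sq_abs t
    have h4 := sq_abs x
    rw [abs_mul]
    nlinarith
  exact (hg.integrable_mul hf).congr (Filter.Eventually.of_forall fun x => mul_assoc _ _ _)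

theorem integral_pow_mul_gaussian_mul_eq_zero {f : L2} (hf : ∀ n, inner ℂ (hermiteL n) f = 0)
    (k : ℕ) : ∫ x : ℝ, (x : ℂ) ^ k * gaussian x * f x = 0 := by
  have hreal : IsRealValued (posS^[k] gaussian) := by
    induction k with
    | zero => intro x; simp only [Function.iterate_zero, id, gaussian_apply, Complex.conj_ofReal]
    | succ k ih => rw [Function.iterate_succ_apply']; exact ih.posS
  have h1 : inner ℂ (toL2 (posS^[k] gaussian)) f = 0 := by
    have h2 : Submodule.span ℂ (Set.range hermiteS) ≤
        (Submodule.span ℂ {f})ᗮ.comap (toL2 : 𝓢(ℝ, ℂ) →ₗ[ℂ] L2) := by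
      rw [Submodule.span_le]
      rintro _ ⟨n, rfl⟩
      exact Submodule.mem_orthogonal_singleton_iff_inner_left.2 (hf n)
    exact Submodule.mem_orthogonal_singleton_iff_inner_left.1
      (h2 (posS_iterate_gaussian_mem_span k))
  rw [inner_toL2 hreal] at h1
  simpa only [posS_iterate_gaussian_apply] using h1

/-- Expand the exponential and integrate term by term: every moment of the Gaussian times `f`
vanishes. -/
theorem integral_exp_mul_gaussian_mul_eq_zero {f : L2} (hf : ∀ n, inner ℂ (hermiteL n) f = 0)
    (t : ℝ) : ∫ x : ℝ, Complex.exp ((t * x : ℝ) * Complex.I) * (gaussian x * f x) = 0 := by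
  have hfm : AEStronglyMeasurable f (volume : Measure ℝ) := (Lp.memLp f).1
  have hgm : AEStronglyMeasurable (fun x => gaussian x * f x) (volume : Measure ℝ) :=
    gaussian.continuous.aestronglyMeasurable.mul hfm
  have hnorm : ∀ x, ‖gaussian x * f x‖ = rexp (-(x ^ 2 / 2)) * ‖f x‖ := fun x => by
    rw [norm_mul, gaussian_apply, Complex.norm_real, Real.norm_eq_abs, Real.abs_exp]
  have hexp : ∀ x : ℝ, HasSum (fun n : ℕ => |t * x| ^ n / n.factorial *
      (rexp (-(x ^ 2 / 2)) * ‖f x‖)) (rexp (|t * x|) * (rexp (-(x ^ 2 / 2)) * ‖f x‖)) := fun x => by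
    have := NormedSpace.expSeries_div_hasSum_exp (|t * x|)
    rw [← Real.exp_eq_exp_ℝ] at this
    exact this.mul_right _
  have hcexp : ∀ z : ℂ, HasSum (fun n : ℕ => z ^ n / n.factorial) (Complex.exp z) := fun z => by
    rw [Complex.exp_eq_exp_ℂ]
    exact NormedSpace.expSeries_div_hasSum_exp z
  have h := hasSum_integral_of_dominated_convergence (μ := (volume : Measure ℝ))
    (F := fun (n : ℕ) (x : ℝ) => (((t * x : ℝ) * Complex.I) ^ n / n.factorial) *
      (gaussian x * f x))
    (f := fun x : ℝ => Complex.exp ((t * x : ℝ) * Complex.I) * (gaussian x * f x))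
    (fun n x => |t * x| ^ n / n.factorial * (rexp (-(x ^ 2 / 2)) * ‖f x‖)) ?_ ?_ ?_ ?_ ?_
  · refine h.unique ?_
    convert hasSum_zero with n
    have h1 : ∀ x : ℝ, (((t * x : ℝ) * Complex.I) ^ n / n.factorial) * (gaussian x * f x) =
        ((t * Complex.I) ^ n / n.factorial) * ((x : ℂ) ^ n * gaussian x * f x) := fun x => by
      push_cast; ring
    simp only [h1]
    rw [integral_const_mul, integral_pow_mul_gaussian_mul_eq_zero hf, mul_zero]
  · intro n
    refine AEStronglyMeasurable.mul (Continuous.aestronglyMeasurable ?_) hgm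
    fun_prop
  · refine fun n => Filter.Eventually.of_forall fun x => le_of_eq ?_
    rw [norm_mul, hnorm, norm_div, norm_pow, norm_mul, Complex.norm_real, Complex.norm_I, mul_one,
      Complex.norm_natCast, Real.norm_eq_abs]
  · exact Filter.Eventually.of_forall fun x => (hexp x).summable
  · simp only [fun x => (hexp x).tsum_eq]
    exact integrable_exp_mul_abs_mul_gaussian_mul t f
  · exact Filter.Eventually.of_forall fun x => (hcexp _).mul_right _

/-- The Gaussian times `f` has zero Fourier transform, and the Gaussian vanishes nowhere. -/
theorem eq_zero_of_inner_hermiteL_eq_zero {f : L2} (hf : ∀ n, inner ℂ (hermiteL n) f = 0) :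
    f = 0 := by
  have hint : Integrable fun x => gaussian x * f x := by
    refine (integrable_exp_mul_abs_mul_gaussian_mul 0 f).mono'
      (gaussian.continuous.aestronglyMeasurable.mul (Lp.memLp f).1)
      (Filter.Eventually.of_forall fun x => le_of_eq ?_)
    rw [norm_mul, gaussian_apply, Complex.norm_real, Real.norm_eq_abs, Real.abs_exp, zero_mul,
      abs_zero, Real.exp_zero, one_mul]
  have h : 𝓕 (fun x => gaussian x * f x) = 0 := by
    funext w
    rw [fourier_real_eq_integral_exp_smul, Pi.zero_apply,
      ← integral_exp_mul_gaussian_mul_eq_zero hf (-2 * π * w)]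
    refine integral_congr_ae (Filter.Eventually.of_forall fun x => ?_)
    simp only [smul_eq_mul]
    congr 4
    ring
  refine Lp.ext ?_
  filter_upwards [ae_eq_zero_of_fourier_eq_zero hint h, Lp.coeFn_zero ℂ 2 (volume : Measure ℝ)]
    with x hx h0
  rw [h0, Pi.zero_apply]
  refine (mul_eq_zero.1 hx).resolve_left ?_
  rw [gaussian_apply]
  exact Complex.ofReal_ne_zero.2 (Real.exp_ne_zero _)

/-- The Hilbert basis of `L²(ℝ)` given by the Hermite functions. -/
noncomputable def hermiteBasis : HilbertBasis ℕ ℂ L2 :=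
  HilbertBasis.mkOfOrthogonalEqBot orthonormal_hermiteL (by
    rw [eq_bot_iff]
    intro f hf
    refine eq_zero_of_inner_hermiteL_eq_zero fun n => ?_
    exact hf _ (Submodule.subset_span ⟨n, rfl⟩))

theorem hermiteBasis_apply (n : ℕ) : hermiteBasis n = hermiteL n := by
  rw [hermiteBasis, HilbertBasis.coe_mkOfOrthogonalEqBot]

end HermiteComplete

/-! ### Operators and domains in Hermite coefficients. -/

section Coefficients

open Real Filter Topology

/-- The coefficients with respect to the Hermite functions. -/
noncomputable def coef (n : ℕ) : L2 →L[ℂ] ℂ := innerSL ℂ (hermiteL n)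

theorem coef_apply (n : ℕ) (f : L2) : coef n f = inner ℂ (hermiteL n) f := rfl

theorem hermiteBasis_repr (f : L2) (n : ℕ) : hermiteBasis.repr f n = coef n f := by
  rw [HilbertBasis.repr_apply_apply, hermiteBasis_apply, coef_apply]

theorem coef_ext {f g : L2} (h : ∀ n, coef n f = coef n g) : f = g := by
  apply hermiteBasis.repr.injective
  ext n
  rw [hermiteBasis_repr, hermiteBasis_repr, h]

theorem hasSum_coef (f : L2) : HasSum (fun n => coef n f • hermiteL n) f := by
  have := hermiteBasis.hasSum_repr f
  simpa only [hermiteBasis_repr, hermiteBasis_apply] using this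

theorem hasSum_norm_coef_sq (f : L2) : HasSum (fun n => ‖coef n f‖ ^ 2) (‖f‖ ^ 2) := by
  have h := lp.hasSum_norm (p := 2) (by norm_num) (hermiteBasis.repr f)
  simpa [hermiteBasis_repr] using h

theorem summable_norm_coef_sq (f : L2) : Summable fun n => ‖coef n f‖ ^ 2 :=
  (hasSum_norm_coef_sq f).summable

theorem coef_hermiteL (m n : ℕ) : coef m (hermiteL n) = if m = n then 1 else 0 :=
  inner_hermiteL m n

theorem exists_coef_eq {c : ℕ → ℂ} (hc : Summable fun n => ‖c n‖ ^ 2) :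
    ∃ f : L2, ∀ n, coef n f = c n := by
  have hmem : Memℓp c 2 := by
    rw [memℓp_gen_iff (by norm_num)]
    simpa using hc
  refine ⟨hermiteBasis.repr.symm ⟨c, hmem⟩, fun n => ?_⟩
  rw [← hermiteBasis_repr, LinearIsometryEquiv.apply_symm_apply]

theorem hasSum_inner_coef (f g : L2) :
    HasSum (fun n => (starRingEnd ℂ) (coef n f) * coef n g) (inner ℂ f g) := by
  have h := hermiteBasis.hasSum_inner_mul_inner f g
  refine h.congr_fun fun n => ?_
  rw [hermiteBasis_apply, coef_apply, coef_apply, inner_conj_symm]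

theorem inner_eq_inner_of_coef {f g f' g' : L2}
    (h : ∀ n, (starRingEnd ℂ) (coef n f) * coef n g = (starRingEnd ℂ) (coef n f') * coef n g') :
    inner ℂ f g = inner ℂ f' g' :=
  (hasSum_inner_coef f g).unique ((hasSum_inner_coef f' g').congr_fun h)

theorem norm_le_of_norm_coef_le {f g : L2} {C : ℝ} (hC : 0 ≤ C)
    (h : ∀ n, ‖coef n f‖ ≤ C * ‖coef n g‖) : ‖f‖ ≤ C * ‖g‖ := by
  refine le_of_sq_le_sq ?_ (by positivity)
  rw [mul_pow]
  refine hasSum_le (fun n => ?_) (hasSum_norm_coef_sq f) ((hasSum_norm_coef_sq g).mul_left (C ^ 2))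
  rw [← mul_pow]
  exact pow_le_pow_left₀ (norm_nonneg _) (h n) 2

theorem tendsto_sum_coef (f : L2) :
    Tendsto (fun N => ∑ n ∈ Finset.range N, coef n f • hermiteL n) atTop (𝓝 f) :=
  (hasSum_coef f).tendsto_sum_nat

theorem coef_ann (f : ann.domain) (n : ℕ) :
    coef n (ann f) = √(n + 1 : ℝ) * coef (n + 1) (f : L2) := inner_hermiteL_ann n f

theorem coef_zero_cre (f : cre.domain) : coef 0 (cre f) = 0 := inner_hermiteL_zero_cre f

theorem coef_succ_cre (f : cre.domain) (n : ℕ) :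
    coef (n + 1) (cre f) = √(n + 1 : ℝ) * coef n (f : L2) := inner_hermiteL_succ_cre n f

theorem norm_sqrt_mul_sq {t : ℝ} (ht : 0 ≤ t) (z : ℂ) : ‖(√t : ℂ) * z‖ ^ 2 = t * ‖z‖ ^ 2 := by
  rw [norm_mul, mul_pow, Complex.norm_real, Real.norm_eq_abs, sq_abs, Real.sq_sqrt ht]

/-- The truncated Hermite expansions are Schwartz functions, and their images under `a` and `a*`
converge to the candidates `A` and `C`. Closedness of both graphs carries this to `f`. -/
theorem mem_ann_domain_of_summable {f : L2} (h : Summable fun n : ℕ => (n : ℝ) * ‖coef n f‖ ^ 2) :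
    f ∈ ann.domain := by
  have hA : Summable fun n : ℕ => ‖(√(n + 1 : ℝ) : ℂ) * coef (n + 1) f‖ ^ 2 := by
    refine ((summable_nat_add_iff 1).2 h).congr fun n => ?_
    rw [norm_sqrt_mul_sq (by positivity)]
    push_cast
    rfl
  obtain ⟨A, hA⟩ := exists_coef_eq hA
  -- The entry at `0` vanishes because the range of `a*` is orthogonal to `h_0`.
  let d : ℕ → ℂ := fun n => Nat.casesOn n 0 fun n => (√(n + 1 : ℝ) : ℂ) * coef n f
  have hd0 : d 0 = 0 := rfl
  have hd : ∀ n, d (n + 1) = (√(n + 1 : ℝ) : ℂ) * coef n f := fun n => rfl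
  have hC : Summable fun n : ℕ => ‖d n‖ ^ 2 := by
    rw [← summable_nat_add_iff 1]
    refine (h.add (summable_norm_coef_sq f)).congr fun n => ?_
    rw [norm_sqrt_mul_sq (by positivity)]
    ring
  obtain ⟨C, hC⟩ := exists_coef_eq hC
  let F : ℕ → 𝓢(ℝ, ℂ) := fun N => ∑ n ∈ Finset.range N, coef n f • hermiteS n
  have hF : ∀ N, toL2 (F N) = ∑ n ∈ Finset.range N, coef n f • hermiteL n := fun N => by
    simp only [F, map_sum, map_smul, hermiteL]
  have hFA : ∀ N, toL2 (annS (F (N + 1))) = ∑ n ∈ Finset.range N, coef n A • hermiteL n := by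
    intro N
    simp only [F, Finset.sum_range_succ' _ N, map_add, map_sum, map_smul, annS_hermiteS_zero,
      annS_hermiteS_succ, smul_zero, add_zero, smul_smul, hA, hermiteL]
    exact Finset.sum_congr rfl fun n _ => by rw [mul_comm]
  have hFC : ∀ N, toL2 (creS (F N)) = ∑ n ∈ Finset.range (N + 1), coef n C • hermiteL n := by
    intro N
    simp only [F, Finset.sum_range_succ' _ N, map_sum, map_smul, creS_hermiteS, smul_smul, hC,
      hermiteL, hd0, hd, zero_smul, add_zero]
    exact Finset.sum_congr rfl fun n _ => by rw [mul_comm]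
  have hlim : Tendsto (fun N => toL2 (F (N + 1))) atTop (𝓝 f) := by
    simp only [hF]
    exact (tendsto_sum_coef f).comp (tendsto_add_atTop_nat 1)
  have hlimA : Tendsto (fun N => toL2 (annS (F (N + 1)))) atTop (𝓝 A) := by
    simp only [hFA]
    exact tendsto_sum_coef A
  have hlimC : Tendsto (fun N => toL2 (creS (F (N + 1)))) atTop (𝓝 C) := by
    simp only [hFC]
    exact (tendsto_sum_coef C).comp (tendsto_add_atTop_nat 2)
  have hpos : (f, ((1 / √2 : ℝ) : ℂ) • (A + C)) ∈ posGraph := by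
    refine isClosed_posGraph.mem_of_tendsto
      (hlim.prodMk_nhds ((hlimA.add hlimC).const_smul _)) (Eventually.of_forall fun N => ?_)
    rw [← map_add, ← map_smul, ← posS_eq]
    exact toL2_mem_posGraph _
  have hder : (f, ((1 / √2 : ℝ) : ℂ) • (A - C)) ∈ derivGraph := by
    refine isClosed_derivGraph.mem_of_tendsto
      (hlim.prodMk_nhds ((hlimA.sub hlimC).const_smul _)) (Eventually.of_forall fun N => ?_)
    rw [← map_sub, ← map_smul, ← derivS_eq]
    exact toL2_mem_derivGraph _
  exact (mem_ladder_of_mem_graphs hder hpos).1.1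

theorem mem_ann_domain_iff (f : L2) :
    f ∈ ann.domain ↔ Summable fun n : ℕ => (n : ℝ) * ‖coef n f‖ ^ 2 := by
  refine ⟨fun h => ?_, mem_ann_domain_of_summable⟩
  rw [← summable_nat_add_iff 1]
  refine (summable_norm_coef_sq (ann ⟨f, h⟩)).congr fun n => ?_
  rw [coef_ann, norm_sqrt_mul_sq (by positivity)]
  push_cast
  rfl

theorem mem_num_domain_iff (f : L2) :
    f ∈ num.domain ↔ Summable fun n : ℕ => (n : ℝ) ^ 2 * ‖coef n f‖ ^ 2 := by
  have hle : (Summable fun n : ℕ => (n : ℝ) ^ 2 * ‖coef n f‖ ^ 2) → f ∈ ann.domain := fun h => by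
    rw [mem_ann_domain_iff]
    refine h.of_nonneg_of_le (fun n => by positivity) fun n => ?_
    gcongr
    exact_mod_cast Nat.le_self_pow two_ne_zero n
  have key : ∀ h : f ∈ ann.domain, ann ⟨f, h⟩ ∈ ann.domain ↔
      Summable fun n : ℕ => (n : ℝ) ^ 2 * ‖coef n f‖ ^ 2 := by
    intro h
    have h1 : (Summable fun n : ℕ => ((n + 1 : ℕ) : ℝ) * ‖coef (n + 1) f‖ ^ 2) :=
      (summable_nat_add_iff 1).2 ((mem_ann_domain_iff f).1 h)
    have h2 : ∀ n : ℕ, (n : ℝ) * ‖coef n (ann ⟨f, h⟩)‖ ^ 2 =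
        ((n + 1 : ℕ) : ℝ) ^ 2 * ‖coef (n + 1) f‖ ^ 2 - ((n + 1 : ℕ) : ℝ) * ‖coef (n + 1) f‖ ^ 2 := by
      intro n
      rw [coef_ann, norm_sqrt_mul_sq (by positivity)]
      push_cast
      ring
    rw [mem_ann_domain_iff, summable_congr h2,
      ← summable_nat_add_iff (f := fun n : ℕ => (n : ℝ) ^ 2 * ‖coef n f‖ ^ 2) 1]
    constructor
    · intro h3
      simpa using h3.add h1
    · intro h3
      exact h3.sub h1
  constructor
  · rintro ⟨h, h'⟩
    exact (key h).1 h'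
  · intro h
    exact ⟨hle h, (key (hle h)).2 h⟩

/-- The domain of `a²` is that of `a* a` by definition; for `a*²` the two summability conditions
differ by `(2n + 1) ‖coef n f‖²`, summable on the domain of `a`. -/
theorem pcomp_domain_cre_cre : (pcomp cre cre).domain = num.domain := by
  ext f
  have key : ∀ h : f ∈ cre.domain, cre ⟨f, h⟩ ∈ ann.domain ↔ f ∈ num.domain := by
    intro h
    have h0 := (mem_ann_domain_iff f).1 h
    have h1 := (h0.mul_left 2).add (summable_norm_coef_sq f)
    have h2 : ∀ n : ℕ, ((n + 1 : ℕ) : ℝ) * ‖coef (n + 1) (cre ⟨f, h⟩)‖ ^ 2 =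
        (n : ℝ) ^ 2 * ‖coef n f‖ ^ 2 + (2 * ((n : ℝ) * ‖coef n f‖ ^ 2) + ‖coef n f‖ ^ 2) := by
      intro n
      rw [coef_succ_cre, norm_sqrt_mul_sq (by positivity)]
      push_cast
      ring
    rw [mem_ann_domain_iff, ← summable_nat_add_iff 1, summable_congr h2, mem_num_domain_iff]
    exact ⟨fun h3 => by simpa using h3.sub h1, fun h3 => h3.add h1⟩
  constructor
  · rintro ⟨h, h'⟩
    exact (key h).1 h'
  · intro h
    exact ⟨h.1, (key h.1).2 h⟩

theorem sqrt_mul_sqrt_self_coe {t : ℝ} (ht : 0 ≤ t) : (√t : ℂ) * (√t : ℂ) = t := by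
  rw [← Complex.ofReal_mul, Real.mul_self_sqrt ht]

theorem coef_num (f : num.domain) (n : ℕ) : coef n (num f) = n * coef n (f : L2) := by
  cases n with
  | zero => rw [Nat.cast_zero, zero_mul]; exact coef_zero_cre _
  | succ n =>
    have h : coef (n + 1) (num f) = √(n + 1 : ℝ) * coef n (ann ⟨f, f.2.1⟩) := coef_succ_cre _ _
    rw [h, coef_ann, ← mul_assoc, sqrt_mul_sqrt_self_coe (by positivity)]
    push_cast
    rfl

theorem coef_ann_ann (f : (pcomp ann ann).domain) (n : ℕ) :
    coef n (pcomp ann ann f) = √(n + 1 : ℝ) * √(n + 2 : ℝ) * coef (n + 2) (f : L2) := by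
  have h : coef n (pcomp ann ann f) = √(n + 1 : ℝ) * coef (n + 1) (ann ⟨f, f.2.1⟩) := coef_ann _ _
  rw [h, coef_ann, ← mul_assoc]
  congr 4
  push_cast
  ring_nf

theorem coef_zero_cre_cre (f : (pcomp cre cre).domain) : coef 0 (pcomp cre cre f) = 0 :=
  coef_zero_cre _

theorem coef_one_cre_cre (f : (pcomp cre cre).domain) : coef 1 (pcomp cre cre f) = 0 := by
  have h : coef 1 (pcomp cre cre f) = √((0 : ℕ) + 1 : ℝ) * coef 0 (cre ⟨f, f.2.1⟩) :=
    coef_succ_cre _ 0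
  rw [h, coef_zero_cre, mul_zero]

theorem coef_add_two_cre_cre (f : (pcomp cre cre).domain) (n : ℕ) :
    coef (n + 2) (pcomp cre cre f) = √(n + 1 : ℝ) * √(n + 2 : ℝ) * coef n (f : L2) := by
  have h : coef (n + 2) (pcomp cre cre f) =
    √((n + 1 : ℕ) + 1 : ℝ) * coef (n + 1) (cre ⟨f, f.2.1⟩) := coef_succ_cre _ (n + 1)
  rw [h, coef_succ_cre, ← mul_assoc, mul_comm (√(n + 1 : ℝ) : ℂ)]
  congr 4
  push_cast
  ring_nf

theorem hermiteL_mem_eigenspace_num (n : ℕ) : hermiteL n ∈ eigenspace num n := by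
  have h : hermiteL n ∈ num.domain := by
    rw [mem_num_domain_iff]
    refine summable_of_ne_finset_zero (s := {n}) fun m hm => ?_
    rw [coef_hermiteL, if_neg (by simpa using hm)]
    simp
  refine ⟨h, coef_ext fun m => ?_⟩
  rw [coef_num, map_smul, coef_hermiteL, smul_eq_mul]
  split_ifs with hm
  · rw [hm]
  · simp

/-- The eigenvalues `n` are simple: an eigenvector has only one nonzero coefficient. -/
theorem eigenprojection_num (n : ℕ) (f : L2) :
    eigenprojection num n f = coef n f • hermiteL n := by
  refine eigenprojection_eq (Submodule.smul_mem _ _ (hermiteL_mem_eigenspace_num n)) ?_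
  rintro e ⟨he, he'⟩
  have h : e = coef n e • hermiteL n := by
    refine coef_ext fun m => ?_
    rw [map_smul, coef_hermiteL, smul_eq_mul]
    split_ifs with hm
    · rw [hm, mul_one]
    · have h1 := coef_num ⟨e, he⟩ m
      rw [he', map_smul, smul_eq_mul] at h1
      rw [mul_zero]
      by_contra h0
      exact hm (Nat.cast_injective (mul_right_cancel₀ h0 h1)).symm
  rw [h, inner_smul_left, inner_smul_left, inner_smul_right, inner_hermiteL, if_pos rfl, mul_one,
    coef_apply n f]

theorem coef_expNum (t : ℝ) (f : L2) (n : ℕ) :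
    coef n (expNum t f) = Complex.exp (-Complex.I * t * n) * coef n f := by
  have h1 : ∀ n : ℕ, ‖Complex.exp (-Complex.I * t * n)‖ = 1 := fun n => by
    have : -Complex.I * t * n = ((-(t * n) : ℝ) : ℂ) * Complex.I := by push_cast; ring
    rw [this, Complex.norm_exp_ofReal_mul_I]
  obtain ⟨g, hg⟩ := exists_coef_eq (c := fun n => Complex.exp (-Complex.I * t * n) * coef n f) (by
    simpa only [norm_mul, h1, one_mul] using summable_norm_coef_sq f)
  have h2 : expNum t f = g := by
    rw [expNum, ← (hasSum_coef g).tsum_eq]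
    refine tsum_congr fun n => ?_
    rw [eigenprojection_num, hg, smul_smul]
  rw [h2, hg]

end Coefficients

/-! ### The oscillator, its compact inverse, and the quadratic ladder operators. -/

section Oscillator

open Real Filter Topology

/-- The operator `a* a + 1/2` as a linear map on its domain. -/
noncomputable def osc : num.domain →ₗ[ℂ] L2 := num.toFun + (1 / 2 : ℂ) • num.domain.subtype

/-- The operator `a²` as a linear map on the domain of `a* a`. -/
noncomputable def annSq : num.domain →ₗ[ℂ] L2 := (pcomp ann ann).toFun

/-- The operator `a*²` as a linear map on the domain of `a* a`. -/
noncomputable def creSq : num.domain →ₗ[ℂ] L2 :=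
  (pcomp cre cre).toFun ∘ₗ Submodule.inclusion pcomp_domain_cre_cre.ge

theorem coef_osc (f : num.domain) (n : ℕ) : coef n (osc f) = (n + 1 / 2) * coef n (f : L2) := by
  have h : osc f = num f + (1 / 2 : ℂ) • (f : L2) := rfl
  rw [h, map_add, map_smul, coef_num, smul_eq_mul, add_mul]

theorem coef_annSq (f : num.domain) (n : ℕ) :
    coef n (annSq f) = √(n + 1 : ℝ) * √(n + 2 : ℝ) * coef (n + 2) (f : L2) := coef_ann_ann f n

theorem coef_zero_creSq (f : num.domain) : coef 0 (creSq f) = 0 := coef_zero_cre_cre _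

theorem coef_one_creSq (f : num.domain) : coef 1 (creSq f) = 0 := coef_one_cre_cre _

theorem coef_add_two_creSq (f : num.domain) (n : ℕ) :
    coef (n + 2) (creSq f) = √(n + 1 : ℝ) * √(n + 2 : ℝ) * coef n (f : L2) :=
  coef_add_two_cre_cre _ n

theorem inner_osc (f g : num.domain) : inner ℂ (osc f) (g : L2) = inner ℂ (f : L2) (osc g) := by
  refine inner_eq_inner_of_coef fun n => ?_
  have h : (starRingEnd ℂ) ((n : ℂ) + 1 / 2) = n + 1 / 2 := by
    simp [Complex.conj_ofNat]
  rw [coef_osc, coef_osc, map_mul, h]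
  ring

/-- The coefficients of `a*² g` start at index 2, so dropping two zero terms aligns the two Parseval
sums. -/
theorem inner_annSq (f g : num.domain) :
    inner ℂ (annSq f) (g : L2) = inner ℂ (f : L2) (creSq g) := by
  have h := (hasSum_nat_add_iff' 2).2 (hasSum_inner_coef (f : L2) (creSq g))
  simp only [Finset.sum_range_succ, Finset.range_zero, Finset.sum_empty, coef_zero_creSq,
    coef_one_creSq, mul_zero, add_zero, sub_zero] at h
  refine (hasSum_inner_coef (annSq f) (g : L2)).unique (h.congr_fun fun n => ?_)
  rw [coef_annSq, coef_add_two_creSq, map_mul, map_mul, Complex.conj_ofReal, Complex.conj_ofReal]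
  ring

theorem inner_creSq (f g : num.domain) :
    inner ℂ (creSq f) (g : L2) = inner ℂ (f : L2) (annSq g) := by
  rw [← inner_conj_symm, ← inner_annSq, inner_conj_symm]

theorem norm_le_of_norm_coef_le_add_two {f g : L2} (h : ∀ n, ‖coef n f‖ ≤ ‖coef (n + 2) g‖) :
    ‖f‖ ≤ ‖g‖ := by
  refine le_of_sq_le_sq ?_ (norm_nonneg _)
  have h1 := (summable_nat_add_iff 2).2 (summable_norm_coef_sq g)
  have h2 := hasSum_le (fun n => pow_le_pow_left₀ (norm_nonneg _) (h n) 2) (hasSum_norm_coef_sq f)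
    h1.hasSum
  refine h2.trans ?_
  rw [← (hasSum_norm_coef_sq g).tsum_eq, ← (summable_norm_coef_sq g).sum_add_tsum_nat_add 2]
  exact le_add_of_nonneg_left (Finset.sum_nonneg fun _ _ => by positivity)

theorem norm_le_of_norm_coef_add_two_le {f g : L2} (h0 : coef 0 f = 0) (h1 : coef 1 f = 0)
    (h : ∀ n, ‖coef (n + 2) f‖ ≤ ‖coef n g‖) : ‖f‖ ≤ ‖g‖ := by
  refine le_of_sq_le_sq ?_ (norm_nonneg _)
  have h2 := (hasSum_nat_add_iff' 2).2 (hasSum_norm_coef_sq f)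
  simp only [Finset.sum_range_succ, Finset.range_zero, Finset.sum_empty, h0, h1, norm_zero, ne_eq,
    OfNat.ofNat_ne_zero, not_false_eq_true, zero_pow, add_zero, sub_zero] at h2
  exact hasSum_le (fun n => pow_le_pow_left₀ (norm_nonneg _) (h n) 2) h2 (hasSum_norm_coef_sq g)

/-- A bounded diagonal operator whose entries tend to zero is compact. -/
theorem exists_compact_coef_eq {d : ℕ → ℝ} (hd : Tendsto d atTop (𝓝 0)) :
    ∃ L : L2 →L[ℂ] L2, IsCompactOperator L ∧ ∀ f n, coef n (L f) = d n * coef n f := by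
  obtain ⟨C, hC⟩ := hd.norm.bddAbove_range
  have hC' : ∀ n, ‖d n‖ ≤ C := fun n => hC ⟨n, rfl⟩
  have hC0 : 0 ≤ C := (norm_nonneg _).trans (hC' 0)
  have hex : ∀ f : L2, ∃ g : L2, ∀ n, coef n g = d n * coef n f := fun f => by
    refine exists_coef_eq (((summable_norm_coef_sq f).mul_left (C ^ 2)).of_nonneg_of_le
      (fun n => by positivity) fun n => ?_)
    rw [norm_mul, mul_pow, Complex.norm_real]
    gcongr
    exact hC' n
  choose D hD using hex
  let L : L2 →L[ℂ] L2 := LinearMap.mkContinuous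
    { toFun := D
      map_add' := fun f g => coef_ext fun n => by simp only [map_add, hD, mul_add]
      map_smul' := fun c f => coef_ext fun n => by
        simp only [map_smul, hD, smul_eq_mul, RingHom.id_apply]
        ring } C (fun f => norm_le_of_norm_coef_le hC0 fun n => by
          change ‖coef n (D f)‖ ≤ _
          rw [hD, norm_mul, Complex.norm_real]
          exact mul_le_mul_of_nonneg_right (hC' n) (norm_nonneg _))
  have hL : ∀ f n, coef n (L f) = d n * coef n f := hD
  refine ⟨L, ?_, hL⟩
  -- Finite rank truncations; they converge in norm because the discarded entries are uniformly
  -- small.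
  let F : ℕ → L2 →L[ℂ] L2 := fun N =>
    ∑ n ∈ Finset.range N, ((d n : ℂ) • (coef n).smulRight (hermiteL n))
  have hF : ∀ N f n, coef n (F N f) = if n < N then d n * coef n f else 0 := by
    intro N f n
    simp only [F, sum_apply, smul_apply, ContinuousLinearMap.smulRight_apply,
      map_sum, map_smul, coef_hermiteL, smul_eq_mul, mul_ite, mul_one, mul_zero,
      Finset.sum_ite_eq, Finset.mem_range]
  have hlim : Tendsto F atTop (𝓝 L) := by
    rw [tendsto_iff_norm_sub_tendsto_zero, Metric.tendsto_atTop]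
    intro ε hε
    obtain ⟨N, hN⟩ := Metric.tendsto_atTop.1 hd (ε / 2) (half_pos hε)
    refine ⟨N, fun m hm => ?_⟩
    rw [dist_zero_right, norm_norm]
    refine lt_of_le_of_lt (ContinuousLinearMap.opNorm_le_bound _ (half_pos hε).le fun f => ?_)
      (half_lt_self hε)
    refine norm_le_of_norm_coef_le (half_pos hε).le fun n => ?_
    rw [sub_apply, map_sub, hF, hL]
    split_ifs with h
    · rw [sub_self, norm_zero]
      have := (half_pos hε).le
      positivity
    · rw [zero_sub, norm_neg, norm_mul, Complex.norm_real]
      have h1 := hN n (by omega)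
      rw [dist_zero_right] at h1
      exact mul_le_mul_of_nonneg_right h1.le (norm_nonneg _)
  refine isCompactOperator_of_tendsto hlim (Eventually.of_forall fun N => ?_)
  have hmem : F N ∈ compactOperator (RingHom.id ℂ) L2 L2 := by
    refine Submodule.sum_mem _ fun n _ => Submodule.smul_mem _ _ ?_
    change IsCompactOperator ((coef n).smulRight (hermiteL n))
    have : (coef n).smulRight (hermiteL n) =
        ((1 : ℂ →L[ℂ] ℂ).smulRight (hermiteL n)) ∘L coef n := by
      ext1 f; simp
    rw [this]
    exact (isCompactOperator_of_locallyCompactSpace_dom (coef n)).clm_comp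
      ((1 : ℂ →L[ℂ] ℂ).smulRight (hermiteL n))
  exact hmem

/-- The operator `a* a + 1/2 + r` has a compact inverse, relative to which `a²` and `a*²` are
contractions. -/
theorem exists_osc_add_inverse {r : ℝ} (hr : 1 ≤ r) :
    ∃ (L : L2 →L[ℂ] L2) (hL : ∀ f, L f ∈ num.domain), IsCompactOperator L ∧
      (∀ f, osc ⟨L f, hL f⟩ + (r : ℂ) • L f = f) ∧
      (∀ u : num.domain, L (osc u + (r : ℂ) • (u : L2)) = u) ∧
      (∀ f, ‖annSq ⟨L f, hL f⟩‖ ≤ ‖f‖) ∧ ∀ f, ‖creSq ⟨L f, hL f⟩‖ ≤ ‖f‖ := by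
  let d : ℕ → ℝ := fun n => (n + 1 / 2 + r)⁻¹
  have hpos : ∀ n : ℕ, 0 < (n + 1 / 2 + r : ℝ) := fun n => by positivity
  have hd : Tendsto d atTop (𝓝 0) := by
    refine Tendsto.inv_tendsto_atTop ?_
    refine tendsto_atTop_mono (fun n => ?_) tendsto_natCast_atTop_atTop
    linarith
  obtain ⟨L, hLc, hL⟩ := exists_compact_coef_eq hd
  have hmul : ∀ (n : ℕ) (z : ℂ), ((n : ℂ) + 1 / 2 + r) * ((d n : ℂ) * z) = z := fun n z => by
    have h1 : ((n : ℂ) + 1 / 2 + r) = ((n + 1 / 2 + r : ℝ) : ℂ) := by push_cast; rfl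
    rw [← mul_assoc, h1, ← Complex.ofReal_mul, mul_inv_cancel₀ (hpos n).ne', Complex.ofReal_one,
      one_mul]
  have hdom : ∀ f, L f ∈ num.domain := fun f => by
    rw [mem_num_domain_iff]
    refine (summable_norm_coef_sq f).of_nonneg_of_le (fun n => by positivity) fun n => ?_
    rw [hL, ← mul_pow, norm_mul, ← mul_assoc, Complex.norm_real, Real.norm_eq_abs,
      abs_of_pos (inv_pos.2 (hpos n))]
    refine pow_le_pow_left₀ (by have := hpos n; positivity) ?_ 2
    refine mul_le_of_le_one_left (norm_nonneg _) ?_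
    rw [mul_inv_le_iff₀ (hpos n)]
    linarith
  have hsqrt : ∀ n : ℕ, √(n + 1 : ℝ) * √(n + 2 : ℝ) ≤ n + 3 / 2 := fun n => by
    rw [← Real.sqrt_mul (by positivity)]
    exact Real.sqrt_le_iff.2 ⟨by positivity, by nlinarith⟩
  -- Used with `m = n + 2` for `a²` and `m = n` for `a*²`; the second case is what requires `r ≥ 1`.
  have hbound : ∀ (n m : ℕ) (z : ℂ), (n : ℝ) + 3 / 2 ≤ m + 1 / 2 + r →
      ‖(√(n + 1 : ℝ) : ℂ) * √(n + 2 : ℝ) * ((d m : ℂ) * z)‖ ≤ ‖z‖ := by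
    intro n m z hnm
    rw [← mul_assoc, ← Complex.ofReal_mul, ← Complex.ofReal_mul, norm_mul, Complex.norm_real,
      Real.norm_eq_abs, abs_of_nonneg (by have := (inv_pos.2 (hpos m)).le; positivity)]
    refine mul_le_of_le_one_left (norm_nonneg _) ?_
    rw [mul_inv_le_iff₀ (hpos m), one_mul]
    exact (hsqrt n).trans hnm
  refine ⟨L, hdom, hLc, fun f => coef_ext fun n => ?_, fun u => coef_ext fun n => ?_, fun f => ?_,
    fun f => ?_⟩
  · rw [map_add, coef_osc, map_smul, smul_eq_mul, ← add_mul, hL, hmul]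
  · rw [hL, map_add, coef_osc, map_smul, smul_eq_mul, ← add_mul, mul_left_comm, hmul]
  · refine norm_le_of_norm_coef_le_add_two fun n => ?_
    rw [coef_annSq, hL]
    refine hbound _ _ _ ?_
    push_cast
    linarith
  · refine norm_le_of_norm_coef_add_two_le (coef_zero_creSq _) (coef_one_creSq _) fun n => ?_
    rw [coef_add_two_creSq, hL]
    exact hbound _ _ _ (by linarith)

end Oscillator

/-! ### Symmetry and compact resolvent of the non-commutative harmonic oscillator. -/

section Resolvent

open Real Filter Topology

/-- The operator `a² - a*²` as a linear map on the domain of `a* a`. -/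
noncomputable def diffSq : num.domain →ₗ[ℂ] L2 := annSq - creSq

theorem inner_diffSq (f g : num.domain) :
    inner ℂ (diffSq f) (g : L2) = -inner ℂ (f : L2) (diffSq g) := by
  rw [diffSq, LinearMap.sub_apply, LinearMap.sub_apply, inner_sub_left, inner_sub_right,
    inner_annSq, inner_creSq, neg_sub]

theorem mem_ncho_domain_iff (α β : ℝ) (f : H) :
    f ∈ (ncho α β).domain ↔ ∀ i, f i ∈ num.domain := by
  constructor
  · intro h i
    exact (h.1 i).1
  · intro h
    refine ⟨fun i => ⟨h i, trivial⟩, fun i => ⟨h i, ?_⟩⟩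
    rw [pcomp_domain_cre_cre]
    exact h i

theorem tensor_apply (M : Matrix (Fin 2) (Fin 2) ℂ) (T : L2 →ₗ.[ℂ] L2) (f : (tensor M T).domain)
    (i : Fin 2) : tensor M T f i = M i 0 • T ⟨f.1 0, f.2 0⟩ + M i 1 • T ⟨f.1 1, f.2 1⟩ :=
  Fin.sum_univ_two _

theorem ncho_apply_zero {α β : ℝ} (f : (ncho α β).domain) (h : ∀ i, f.1 i ∈ num.domain) :
    ncho α β f 0 = (α : ℂ) • osc ⟨f.1 0, h 0⟩ - (1 / 2 : ℂ) • diffSq ⟨f.1 1, h 1⟩ := by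
  have h1 : ncho α β f 0 = tensor !![(α : ℂ), 0; 0, (β : ℂ)] numHalf ⟨f.1, f.2.1⟩ 0 +
      (1 / 2 : ℂ) • tensor matJ (pcomp ann ann - pcomp cre cre) ⟨f.1, f.2.2⟩ 0 := rfl
  rw [h1, tensor_apply, tensor_apply]
  simp only [matJ, Matrix.of_apply, Matrix.cons_val', Matrix.cons_val_zero, Matrix.cons_val_one,
    Matrix.cons_val_fin_one, zero_smul, add_zero, zero_add, neg_smul, one_smul, smul_neg]
  exact (sub_eq_add_neg _ _).symm

theorem ncho_apply_one {α β : ℝ} (f : (ncho α β).domain) (h : ∀ i, f.1 i ∈ num.domain) :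
    ncho α β f 1 = (β : ℂ) • osc ⟨f.1 1, h 1⟩ + (1 / 2 : ℂ) • diffSq ⟨f.1 0, h 0⟩ := by
  have h1 : ncho α β f 1 = tensor !![(α : ℂ), 0; 0, (β : ℂ)] numHalf ⟨f.1, f.2.1⟩ 1 +
      (1 / 2 : ℂ) • tensor matJ (pcomp ann ann - pcomp cre cre) ⟨f.1, f.2.2⟩ 1 := rfl
  rw [h1, tensor_apply, tensor_apply]
  simp only [matJ, Matrix.of_apply, Matrix.cons_val', Matrix.cons_val_zero, Matrix.cons_val_one,
    Matrix.cons_val_fin_one, zero_smul, add_zero, zero_add, one_smul]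
  rfl

theorem isFormalAdjoint_ncho (α β : ℝ) : (ncho α β).IsFormalAdjoint (ncho α β) := by
  intro f g
  have hf := (mem_ncho_domain_iff α β f).1 f.2
  have hg := (mem_ncho_domain_iff α β g).1 g.2
  rw [PiLp.inner_apply, PiLp.inner_apply, Fin.sum_univ_two, Fin.sum_univ_two,
    ncho_apply_zero f hf, ncho_apply_one f hf, ncho_apply_zero g hg, ncho_apply_one g hg]
  have h1 := inner_osc ⟨f.1 0, hf 0⟩ ⟨g.1 0, hg 0⟩
  have h2 := inner_osc ⟨f.1 1, hf 1⟩ ⟨g.1 1, hg 1⟩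
  have h3 := inner_diffSq ⟨f.1 0, hf 0⟩ ⟨g.1 1, hg 1⟩
  have h4 := inner_diffSq ⟨f.1 1, hf 1⟩ ⟨g.1 0, hg 0⟩
  simp only at h1 h2 h3 h4
  have h5 : (starRingEnd ℂ) (1 / 2 : ℂ) = 1 / 2 := by simp [Complex.conj_ofNat]
  rw [inner_sub_left, inner_add_left, inner_sub_right, inner_add_right]
  simp only [inner_smul_left, inner_smul_right, Complex.conj_ofReal, h1, h2, h3, h4, h5]
  ring

/-- The operator on `L²(ℝ) ⊕ L²(ℝ)` with a single entry. -/
noncomputable def entry (i j : Fin 2) (A : L2 →L[ℂ] L2) : H →L[ℂ] H :=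
  (((PiLp.continuousLinearEquiv 2 ℂ fun _ : Fin 2 => L2).symm : (Fin 2 → L2) →L[ℂ] H) ∘L
    ContinuousLinearMap.single ℂ (fun _ : Fin 2 => L2) i) ∘L
      (A ∘L PiLp.proj 2 (fun _ : Fin 2 => L2) j)

theorem entry_apply (i j k : Fin 2) (A : L2 →L[ℂ] L2) (f : H) :
    entry i j A f k = if k = i then A (f j) else 0 := by
  have h : entry i j A f k = Pi.single (M := fun _ : Fin 2 => L2) i (A (f j)) k := rfl
  rw [h, Pi.single_apply]

theorem isCompactOperator_entry (i j : Fin 2) {A : L2 →L[ℂ] L2} (hA : IsCompactOperator A) :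
    IsCompactOperator (entry i j A) :=
  (hA.comp_clm (PiLp.proj 2 (fun _ : Fin 2 => L2) j)).clm_comp
    (((PiLp.continuousLinearEquiv 2 ℂ fun _ : Fin 2 => L2).symm : (Fin 2 → L2) →L[ℂ] H) ∘L
      ContinuousLinearMap.single ℂ (fun _ : Fin 2 => L2) i)

/-- Apply the Neumann series to `1 - S² = (1 + S)(1 - S)`, whose factors commute; `S` itself need
not be a contraction. -/
theorem isUnit_one_add_of_norm_apply_apply_le {E : Type*} [NormedAddCommGroup E] [NormedSpace ℂ E]
    [CompleteSpace E] (S : E →L[ℂ] E) {θ : ℝ} (h0 : 0 ≤ θ) (h1 : θ < 1)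
    (hS : ∀ f, ‖S (S f)‖ ≤ θ * ‖f‖) : IsUnit (1 + S) := by
  have h2 : ‖S * S‖ < 1 :=
    (ContinuousLinearMap.opNorm_le_bound _ h0 hS).trans_lt h1
  have h3 : IsUnit (1 - S * S) := (Units.oneSub (S * S) h2).isUnit
  have h4 : 1 - S * S = (1 + S) * (1 - S) := by noncomm_ring
  have h5 : Commute (1 + S) (1 - S) := by
    rw [commute_iff_eq]
    noncomm_ring
  rw [h4, h5.isUnit_mul_iff] at h3
  exact h3.1

/-- With `M` the compact inverse of the diagonal part of `Q + c`, one has `(Q + c) M = 1 + S`, so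
the resolvent is `M (1 + S)⁻¹`. -/
theorem exists_isCompactResolvent_ncho {α β : ℝ} (hα : 0 < α) (hβ : 0 < β) (hαβ : 1 < α * β) :
    ∃ (c : ℝ) (R : H →L[ℂ] H), IsCompactResolvent (ncho α β) c R := by
  -- This makes both `c / α` and `c / β` at least 1, as the contraction bounds for `a²` and `a*²`
  -- require.
  let c : ℝ := α + β
  have hcα : 1 ≤ c / α := by rw [one_le_div hα]; simp only [c]; linarith
  have hcβ : 1 ≤ c / β := by rw [one_le_div hβ]; simp only [c]; linarith
  obtain ⟨L₀, hd₀, hc₀, hr₀, hl₀, ha₀, hb₀⟩ := exists_osc_add_inverse hcα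
  obtain ⟨L₁, hd₁, hc₁, hr₁, hl₁, ha₁, hb₁⟩ := exists_osc_add_inverse hcβ
  have hX : ∀ (L : L2 →L[ℂ] L2) (hL : ∀ f, L f ∈ num.domain) (γ : ℝ), 0 < γ →
      (∀ f, ‖annSq ⟨L f, hL f⟩‖ ≤ ‖f‖) → (∀ f, ‖creSq ⟨L f, hL f⟩‖ ≤ ‖f‖) →
      ∃ X : L2 →L[ℂ] L2, (∀ f, X f = (γ : ℂ)⁻¹ • (1 / 2 : ℂ) • diffSq ⟨L f, hL f⟩) ∧
        ∀ f, ‖X f‖ ≤ γ⁻¹ * ‖f‖ := by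
    intro L hL γ hγ ha hb
    let X : L2 →ₗ[ℂ] L2 := (γ : ℂ)⁻¹ • (1 / 2 : ℂ) • diffSq ∘ₗ (L : L2 →ₗ[ℂ] L2).codRestrict _ hL
    have hX : ∀ f, ‖X f‖ ≤ γ⁻¹ * ‖f‖ := by
      intro f
      have h1 : X f = (γ : ℂ)⁻¹ • (1 / 2 : ℂ) • (annSq ⟨L f, hL f⟩ - creSq ⟨L f, hL f⟩) := rfl
      rw [h1, norm_smul, norm_smul, norm_inv, Complex.norm_real, Real.norm_eq_abs, abs_of_pos hγ]
      have h2 : ‖(1 / 2 : ℂ)‖ = 1 / 2 := by simp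
      rw [h2]
      have h3 := norm_sub_le (annSq ⟨L f, hL f⟩) (creSq ⟨L f, hL f⟩)
      have h4 := ha f
      have h5 := hb f
      have h6 : 0 ≤ γ⁻¹ := (inv_pos.2 hγ).le
      refine mul_le_mul_of_nonneg_left ?_ h6
      linarith
    exact ⟨X.mkContinuous _ hX, fun f => rfl, hX⟩
  obtain ⟨X₀, hX₀, hn₀⟩ := hX L₀ hd₀ α hα ha₀ hb₀
  obtain ⟨X₁, hX₁, hn₁⟩ := hX L₁ hd₁ β hβ ha₁ hb₁
  let M : H →L[ℂ] H := entry 0 0 ((α : ℂ)⁻¹ • L₀) + entry 1 1 ((β : ℂ)⁻¹ • L₁)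
  let S : H →L[ℂ] H := entry 1 0 X₀ - entry 0 1 X₁
  have hM0 : ∀ f, M f 0 = (α : ℂ)⁻¹ • L₀ (f 0) := fun f => by
    simp [M, entry_apply]
  have hM1 : ∀ f, M f 1 = (β : ℂ)⁻¹ • L₁ (f 1) := fun f => by
    simp [M, entry_apply]
  have hS0 : ∀ f, S f 0 = -X₁ (f 1) := fun f => by
    simp [S, entry_apply]
  have hS1 : ∀ f, S f 1 = X₀ (f 0) := fun f => by
    simp [S, entry_apply]
  have hMc : IsCompactOperator M := by
    have h1 : IsCompactOperator ((α : ℂ)⁻¹ • L₀) := hc₀.smul (α : ℂ)⁻¹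
    have h2 : IsCompactOperator ((β : ℂ)⁻¹ • L₁) := hc₁.smul (β : ℂ)⁻¹
    exact (isCompactOperator_entry 0 0 h1).add (isCompactOperator_entry 1 1 h2)
  have hMd : ∀ f, M f ∈ (ncho α β).domain := fun f => by
    rw [mem_ncho_domain_iff, Fin.forall_fin_two, hM0, hM1]
    exact ⟨Submodule.smul_mem _ _ (hd₀ _), Submodule.smul_mem _ _ (hd₁ _)⟩
  have hθ : (α * β)⁻¹ < 1 := inv_lt_one_of_one_lt₀ hαβ
  have hθ0 : 0 ≤ (α * β)⁻¹ := by positivity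
  -- `S` is off-diagonal with entries bounded by `1/α` and `1/β`, one of which may exceed 1; `S²` is
  -- diagonal and involves only their product.
  have hS : ∀ f, ‖S (S f)‖ ≤ (α * β)⁻¹ * ‖f‖ := by
    intro f
    refine le_of_sq_le_sq ?_ (by positivity)
    rw [mul_pow, PiLp.norm_sq_eq_of_L2, PiLp.norm_sq_eq_of_L2, Fin.sum_univ_two, Fin.sum_univ_two,
      hS0, hS1, hS1, hS0, map_neg, norm_neg, norm_neg, mul_add, ← mul_pow, ← mul_pow]
    have h1 : ‖X₁ (X₀ (f 0))‖ ≤ (α * β)⁻¹ * ‖f 0‖ := by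
      refine (hn₁ _).trans ?_
      rw [mul_inv_rev, mul_assoc]
      exact mul_le_mul_of_nonneg_left (hn₀ _) (inv_pos.2 hβ).le
    have h2 : ‖X₀ (X₁ (f 1))‖ ≤ (α * β)⁻¹ * ‖f 1‖ := by
      refine (hn₀ _).trans ?_
      rw [mul_inv, mul_assoc]
      exact mul_le_mul_of_nonneg_left (hn₁ _) (inv_pos.2 hα).le
    exact add_le_add (pow_le_pow_left₀ (norm_nonneg _) h1 2)
      (pow_le_pow_left₀ (norm_nonneg _) h2 2)
  obtain ⟨V, hV⟩ := isUnit_one_add_of_norm_apply_apply_le S hθ0 hθ hS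
  have hV1 : ∀ x, (↑V⁻¹ : H →L[ℂ] H) x + S ((↑V⁻¹ : H →L[ℂ] H) x) = x := fun x => by
    have h : ((V : H →L[ℂ] H) * ↑V⁻¹) x = x := by rw [V.mul_inv]; rfl
    rw [hV] at h
    exact h
  have hV2 : ∀ x, (↑V⁻¹ : H →L[ℂ] H) (x + S x) = x := fun x => by
    have h : ((↑V⁻¹ : H →L[ℂ] H) * V) x = x := by rw [V.inv_mul]; rfl
    rw [hV] at h
    exact h
  have hscale : ∀ {γ : ℝ}, 0 < γ → ∀ (L : L2 →L[ℂ] L2) (hL : ∀ f, L f ∈ num.domain) (f : L2)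
      (h : (γ : ℂ)⁻¹ • L f ∈ num.domain), osc ⟨L f, hL f⟩ + ((c / γ : ℝ) : ℂ) • L f = f →
      (γ : ℂ) • osc ⟨(γ : ℂ)⁻¹ • L f, h⟩ + (c : ℂ) • (γ : ℂ)⁻¹ • L f = f := by
    intro γ hγ L hL f h hf
    have hγ0 : (γ : ℂ) ≠ 0 := Complex.ofReal_ne_zero.2 hγ.ne'
    have h1 : osc ⟨(γ : ℂ)⁻¹ • L f, h⟩ = (γ : ℂ)⁻¹ • osc ⟨L f, hL f⟩ := osc.map_smul _ ⟨L f, hL f⟩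
    rw [h1, smul_inv_smul₀ hγ0, smul_smul, ← div_eq_mul_inv, ← Complex.ofReal_div]
    exact hf
  have hdiff : ∀ (γ : ℂ) (L : L2 →L[ℂ] L2) (hL : ∀ f, L f ∈ num.domain) (f : L2)
      (h : γ⁻¹ • L f ∈ num.domain),
      diffSq ⟨γ⁻¹ • L f, h⟩ = γ⁻¹ • diffSq ⟨L f, hL f⟩ := fun γ L hL f h =>
    diffSq.map_smul _ ⟨L f, hL f⟩
  have key : ∀ v, ncho α β ⟨M v, hMd v⟩ + (c : ℂ) • M v = v + S v := by
    intro v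
    have hd := (mem_ncho_domain_iff α β (M v)).1 (hMd v)
    ext1 i
    fin_cases i
    · change ncho α β ⟨M v, hMd v⟩ 0 + (c : ℂ) • M v 0 = v 0 + S v 0
      rw [ncho_apply_zero _ hd, hS0, hX₁]
      have h1 := hscale hα L₀ hd₀ (v 0) (hM0 v ▸ hd 0) (hr₀ _)
      have h2 := hdiff β L₁ hd₁ (v 1) (hM1 v ▸ hd 1)
      simp only [hM0, hM1, h2]
      rw [smul_comm (1 / 2 : ℂ), sub_add_eq_add_sub, h1, sub_eq_add_neg]
    · change ncho α β ⟨M v, hMd v⟩ 1 + (c : ℂ) • M v 1 = v 1 + S v 1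
      rw [ncho_apply_one _ hd, hS1, hX₀]
      have h1 := hscale hβ L₁ hd₁ (v 1) (hM1 v ▸ hd 1) (hr₁ _)
      have h2 := hdiff α L₀ hd₀ (v 0) (hM0 v ▸ hd 0)
      simp only [hM0, hM1, h2]
      rw [smul_comm (1 / 2 : ℂ), add_right_comm, h1]
  refine ⟨c, M ∘L (↑V⁻¹ : H →L[ℂ] H), hMc.comp_clm _, fun y => ⟨hMd _, ?_⟩, fun x => ?_⟩
  · refine (key _).trans (hV1 y)
  · have hd := (mem_ncho_domain_iff α β x).1 x.2
    obtain ⟨x, hx⟩ := x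
    -- `M` maps onto the whole domain, so the left inverse property also follows from `key`.
    obtain ⟨v, rfl⟩ : ∃ v, M v = x := by
      refine ⟨WithLp.toLp 2 ![(α : ℂ) • (osc ⟨x 0, hd 0⟩ + ((c / α : ℝ) : ℂ) • x 0),
        (β : ℂ) • (osc ⟨x 1, hd 1⟩ + ((c / β : ℝ) : ℂ) • x 1)], ?_⟩
      ext1 i
      fin_cases i
      · change M _ 0 = x 0
        rw [hM0]
        change (α : ℂ)⁻¹ • L₀ ((α : ℂ) • (osc ⟨x 0, hd 0⟩ + ((c / α : ℝ) : ℂ) • x 0)) = x 0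
        rw [map_smul, hl₀ ⟨x 0, hd 0⟩, inv_smul_smul₀ (Complex.ofReal_ne_zero.2 hα.ne')]
      · change M _ 1 = x 1
        rw [hM1]
        change (β : ℂ)⁻¹ • L₁ ((β : ℂ) • (osc ⟨x 1, hd 1⟩ + ((c / β : ℝ) : ℂ) • x 1)) = x 1
        rw [map_smul, hl₁ ⟨x 1, hd 1⟩, inv_smul_smul₀ (Complex.ofReal_ne_zero.2 hβ.ne')]
    change M ((↑V⁻¹ : H →L[ℂ] H) (ncho α β ⟨M v, hx⟩ + (c : ℂ) • M v)) = M v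
    rw [key, hV2]

end Resolvent

/-! ### Transport along linear and unitary bijections. -/

section Conjugation

variable {E F : Type*}

theorem conj_apply [AddCommGroup E] [Module ℂ E] [AddCommGroup F] [Module ℂ F] (e : E ≃ₗ[ℂ] F)
    (T : E →ₗ.[ℂ] E) (x : (conj e T).domain) : conj e T x = e (T ⟨e.symm x.1, x.2⟩) := rfl

theorem mem_eigenspace_conj [AddCommGroup E] [Module ℂ E] [AddCommGroup F] [Module ℂ F]
    (e : E ≃ₗ[ℂ] F) (T : E →ₗ.[ℂ] E) (μ : ℂ) (x : F) :
    x ∈ eigenspace (conj e T) μ ↔ e.symm x ∈ eigenspace T μ := by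
  refine exists_congr fun hx => ?_
  rw [conj_apply, ← LinearEquiv.eq_symm_apply, map_smul]

variable [NormedAddCommGroup E] [InnerProductSpace ℂ E] [NormedAddCommGroup F]
  [InnerProductSpace ℂ F] {T : E →ₗ.[ℂ] E}

theorem isFormalAdjoint_conj (hT : T.IsFormalAdjoint T) (e : E ≃ₗᵢ[ℂ] F) :
    (conj e.toLinearEquiv T).IsFormalAdjoint (conj e.toLinearEquiv T) := by
  rintro ⟨x, hx⟩ ⟨y, hy⟩
  have h := hT ⟨e.symm x, hx⟩ ⟨e.symm y, hy⟩
  have h1 : inner ℂ (e (T ⟨e.symm x, hx⟩)) (e (e.symm y)) =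
      inner ℂ (e (e.symm x)) (e (T ⟨e.symm y, hy⟩)) := by
    rw [e.inner_map_map, e.inner_map_map]
    exact h
  rw [e.apply_symm_apply, e.apply_symm_apply] at h1
  exact h1

theorem IsCompactResolvent.conj {c : ℝ} {R : E →L[ℂ] E} (h : IsCompactResolvent T c R)
    (e : E ≃ₗᵢ[ℂ] F) :
    ∃ R' : F →L[ℂ] F, IsCompactResolvent (NcHO.conj e.toLinearEquiv T) c R' := by
  let e₁ : E →L[ℂ] F := e.toContinuousLinearEquiv
  let e₂ : F →L[ℂ] E := e.symm.toContinuousLinearEquiv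
  have h12 : ∀ x, e₁ (e₂ x) = x := e.apply_symm_apply
  have h21 : ∀ x, e₂ (e₁ x) = x := e.symm_apply_apply
  refine ⟨e₁ ∘L R ∘L e₂, ⟨(h.compact.comp_clm e₂).clm_comp e₁, fun y => ?_, ?_⟩⟩
  · obtain ⟨h1, h2⟩ := h.right_inv (e₂ y)
    have h3 : e₂ (e₁ (R (e₂ y))) ∈ T.domain := by rw [h21]; exact h1
    refine ⟨h3, ?_⟩
    have h4 : T ⟨e₂ (e₁ (R (e₂ y))), h3⟩ = T ⟨R (e₂ y), h1⟩ := by congr 2; exact h21 _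
    change e₁ (T ⟨e₂ (e₁ (R (e₂ y))), h3⟩) + (c : ℂ) • e₁ (R (e₂ y)) = y
    rw [h4, ← map_smul, ← map_add, h2, h12]
  · rintro ⟨x, hx⟩
    have h1 := h.left_inv ⟨e₂ x, hx⟩
    change e₁ (R (e₂ (e₁ (T ⟨e₂ x, hx⟩) + (c : ℂ) • x))) = x
    rw [map_add, map_smul, h21, h1, h12]

theorem eigenprojection_congr [CompleteSpace E] {T T' : E →ₗ.[ℂ] E} {μ μ' : ℂ}
    (h : eigenspace T μ = eigenspace T' μ') : eigenprojection T μ = eigenprojection T' μ' := by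
  simp only [eigenprojection, h]

end Conjugation

/-! ### The rotation and the unitary map onto the weighted space. -/

section Unitary

open Real

/-- The operator `exp (-i t a* a)` as a unitary operator. -/
noncomputable def expNumEquiv (t : ℝ) : L2 ≃ₗᵢ[ℂ] L2 where
  toFun := expNum t
  invFun := expNum (-t)
  map_add' f g := coef_ext fun n => by simp only [map_add, coef_expNum, mul_add]
  map_smul' c f := coef_ext fun n => by
    simp only [map_smul, coef_expNum, smul_eq_mul, RingHom.id_apply]
    ring
  left_inv f := coef_ext fun n => by
    rw [coef_expNum, coef_expNum, ← mul_assoc, ← Complex.exp_add]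
    push_cast
    ring_nf
    simp
  right_inv f := coef_ext fun n => by
    rw [coef_expNum, coef_expNum, ← mul_assoc, ← Complex.exp_add]
    push_cast
    ring_nf
    simp
  norm_map' f := by
    change ‖expNum t f‖ = ‖f‖
    rw [← sq_eq_sq₀ (norm_nonneg _) (norm_nonneg _), ← (hasSum_norm_coef_sq f).tsum_eq,
      ← (hasSum_norm_coef_sq (expNum t f)).tsum_eq]
    refine tsum_congr fun n => ?_
    have h : -Complex.I * t * n = ((-(t * n) : ℝ) : ℂ) * Complex.I := by push_cast; ring
    rw [coef_expNum, norm_mul, h, Complex.norm_exp_ofReal_mul_I, one_mul]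

/-- The unitary operator `exp (-i (π/4) a* a)`. -/
noncomputable abbrev rot : L2 ≃ₗᵢ[ℂ] L2 := expNumEquiv (π / 4)

theorem coef_rot (n : ℕ) (f : L2) :
    coef n (rot f) = Complex.exp (-Complex.I * (π / 4 : ℝ) * n) * coef n f := coef_expNum _ f n

theorem rot_mem_num_domain_iff (f : L2) : rot f ∈ num.domain ↔ f ∈ num.domain := by
  rw [mem_num_domain_iff, mem_num_domain_iff]
  refine summable_congr fun n => ?_
  have h : -Complex.I * (π / 4 : ℝ) * n = ((-(π / 4 * n) : ℝ) : ℂ) * Complex.I := by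
    push_cast; ring
  rw [coef_rot, norm_mul, h, Complex.norm_exp_ofReal_mul_I, one_mul]

theorem rot_osc (f : num.domain) (h : rot f ∈ num.domain) : rot (osc f) = osc ⟨rot f, h⟩ := by
  refine coef_ext fun n => ?_
  rw [coef_osc, coef_rot, coef_rot, coef_osc]
  ring

/-- Two quanta rotate by `exp(-i π/2) = -i`; this is why the angle is `π/4`, and why `a²` and `a*²`
acquire opposite factors `i` and `-i`. -/
theorem exp_phase_add_two (n : ℕ) :
    Complex.exp (-Complex.I * (π / 4 : ℝ) * (n + 2 : ℕ)) =
      -Complex.I * Complex.exp (-Complex.I * (π / 4 : ℝ) * n) := by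
  have h : -Complex.I * (π / 4 : ℝ) * (n + 2 : ℕ) =
      -(π / 2 * Complex.I) + -Complex.I * (π / 4 : ℝ) * n := by
    push_cast
    ring
  rw [h, Complex.exp_add, Complex.exp_neg, Complex.exp_pi_div_two_mul_I, Complex.inv_I]

theorem rot_annSq (f : num.domain) (h : rot f ∈ num.domain) :
    rot (annSq f) = Complex.I • annSq ⟨rot f, h⟩ := by
  refine coef_ext fun n => ?_
  rw [map_smul, coef_annSq, coef_rot, coef_rot, coef_annSq, exp_phase_add_two, smul_eq_mul]
  linear_combination (Complex.exp (-Complex.I * (π / 4 : ℝ) * n) * √(n + 1 : ℝ) *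
    √(n + 2 : ℝ) * coef (n + 2) (f : L2)) * Complex.I_mul_I

theorem rot_creSq (f : num.domain) (h : rot f ∈ num.domain) :
    rot (creSq f) = -Complex.I • creSq ⟨rot f, h⟩ := by
  refine coef_ext fun n => ?_
  rw [map_smul, coef_rot]
  match n with
  | 0 => rw [coef_zero_creSq, coef_zero_creSq, mul_zero, smul_zero]
  | 1 => rw [coef_one_creSq, coef_one_creSq, mul_zero, smul_zero]
  | n + 2 =>
    rw [coef_add_two_creSq, coef_add_two_creSq, exp_phase_add_two, coef_rot, smul_eq_mul]
    ring

/-- The operator `a² + a*²` as a linear map on the domain of `a* a`. -/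
noncomputable def sumSq : num.domain →ₗ[ℂ] L2 := annSq + creSq

theorem rot_diffSq (f : num.domain) (h : rot f ∈ num.domain) :
    rot (diffSq f) = Complex.I • sumSq ⟨rot f, h⟩ := by
  rw [diffSq, sumSq, LinearMap.sub_apply, LinearMap.add_apply, map_sub, rot_annSq f h,
    rot_creSq f h, neg_smul, sub_neg_eq_add, smul_add]

/-- The upper entry of the diagonal matrix `c`. -/
noncomputable def entryUp (α : ℝ) : ℂ := √α * Complex.exp (Complex.I * (π / 4 : ℝ))

/-- The lower entry of the diagonal matrix `c`. -/
noncomputable def entryLow (β : ℝ) : ℂ := √β * Complex.exp (-(Complex.I * (π / 4 : ℝ)))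

theorem matC_eq (α β : ℝ) : matC α β = !![entryUp α, 0; 0, entryLow β] := by
  have h : (Complex.I * (π / 4 : ℝ)) • sigmaZ =
      Matrix.diagonal ![Complex.I * (π / 4 : ℝ), -(Complex.I * (π / 4 : ℝ))] := by
    ext i j
    fin_cases i <;> fin_cases j <;> simp [sigmaZ]
  rw [matC, h, Matrix.exp_diagonal]
  ext i j
  fin_cases i <;> fin_cases j <;>
    simp [Matrix.mul_apply, Pi.coe_exp, ← Complex.exp_eq_exp_ℂ, entryUp, entryLow]

theorem norm_entryUp (α : ℝ) : ‖entryUp α‖ = √α := by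
  rw [entryUp, mul_comm Complex.I, norm_mul, Complex.norm_exp_ofReal_mul_I, mul_one,
    Complex.norm_real, Real.norm_eq_abs, abs_of_nonneg (Real.sqrt_nonneg _)]

theorem norm_entryLow (β : ℝ) : ‖entryLow β‖ = √β := by
  have h : -(Complex.I * (π / 4 : ℝ)) = ((-(π / 4) : ℝ) : ℂ) * Complex.I := by push_cast; ring
  rw [entryLow, h, norm_mul, Complex.norm_exp_ofReal_mul_I, mul_one,
    Complex.norm_real, Real.norm_eq_abs, abs_of_nonneg (Real.sqrt_nonneg _)]

theorem entryUp_ne_zero {α : ℝ} (hα : 0 < α) : entryUp α ≠ 0 := by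
  rw [← norm_ne_zero_iff, norm_entryUp]
  positivity

theorem entryLow_ne_zero {β : ℝ} (hβ : 0 < β) : entryLow β ≠ 0 := by
  rw [← norm_ne_zero_iff, norm_entryLow]
  positivity

theorem mapI_apply_zero (α β : ℝ) (f : H) : mapI α β f 0 = entryUp α • rot (f 0) := by
  rw [mapI, matC_eq]
  change ∑ j, (!![entryUp α, 0; 0, entryLow β] : Matrix (Fin 2) (Fin 2) ℂ) 0 j • rot (f j) = _
  simp

theorem mapI_apply_one (α β : ℝ) (f : H) : mapI α β f 1 = entryLow β • rot (f 1) := by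
  rw [mapI, matC_eq]
  change ∑ j, (!![entryUp α, 0; 0, entryLow β] : Matrix (Fin 2) (Fin 2) ℂ) 1 j • rot (f j) = _
  simp

theorem ext_H {f g : H} (h0 : f 0 = g 0) (h1 : f 1 = g 1) : f = g := by
  ext1 i
  fin_cases i
  · exact h0
  · exact h1

/-- The map `c ⊗ exp (-i (π/4) a* a)` as a linear bijection. -/
noncomputable def mapIEquiv {α β : ℝ} (hα : 0 < α) (hβ : 0 < β) : H ≃ₗ[ℂ] H where
  toFun := mapI α β
  invFun g := WithLp.toLp 2 ![rot.symm ((entryUp α)⁻¹ • g 0), rot.symm ((entryLow β)⁻¹ • g 1)]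
  map_add' f g := ext_H
    (by rw [PiLp.add_apply, mapI_apply_zero, mapI_apply_zero, mapI_apply_zero, PiLp.add_apply,
      map_add, smul_add])
    (by rw [PiLp.add_apply, mapI_apply_one, mapI_apply_one, mapI_apply_one, PiLp.add_apply,
      map_add, smul_add])
  map_smul' c f := ext_H
    (by rw [PiLp.smul_apply, mapI_apply_zero, mapI_apply_zero, PiLp.smul_apply, map_smul,
      smul_comm, RingHom.id_apply])
    (by rw [PiLp.smul_apply, mapI_apply_one, mapI_apply_one, PiLp.smul_apply, map_smul,
      smul_comm, RingHom.id_apply])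
  left_inv f := ext_H
    (by
      change rot.symm ((entryUp α)⁻¹ • mapI α β f 0) = f 0
      rw [mapI_apply_zero, inv_smul_smul₀ (entryUp_ne_zero hα),
        LinearIsometryEquiv.symm_apply_apply])
    (by
      change rot.symm ((entryLow β)⁻¹ • mapI α β f 1) = f 1
      rw [mapI_apply_one, inv_smul_smul₀ (entryLow_ne_zero hβ),
        LinearIsometryEquiv.symm_apply_apply])
  right_inv g := ext_H
    (by
      rw [mapI_apply_zero]
      change entryUp α • rot (rot.symm ((entryUp α)⁻¹ • g 0)) = g 0
      rw [LinearIsometryEquiv.apply_symm_apply, smul_inv_smul₀ (entryUp_ne_zero hα)])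
    (by
      rw [mapI_apply_one]
      change entryLow β • rot (rot.symm ((entryLow β)⁻¹ • g 1)) = g 1
      rw [LinearIsometryEquiv.apply_symm_apply, smul_inv_smul₀ (entryLow_ne_zero hβ)])

/-- The unitary map `c ⊗ exp (-i (π/4) a* a)` onto the weighted space. -/
noncomputable def unitaryI (α β : ℝ) (hα : 0 < α) (hβ : 0 < β) : H ≃ₗᵢ[ℂ] Hab α β hα hβ where
  toLinearEquiv := (mapIEquiv hα hβ).trans (toHab α β hα hβ)
  -- The diagonal entries of `c` have squared moduli `α` and `β`, which cancel the weights `1/α` and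
  -- `1/β`.
  norm_map' f := by
    change ‖toHab α β hα hβ (mapI α β f)‖ = ‖f‖
    rw [← sq_eq_sq₀ (norm_nonneg _) (norm_nonneg _), norm_toHab_sq, mapI_apply_zero,
      mapI_apply_one, norm_smul, norm_smul, norm_entryUp, norm_entryLow,
      LinearIsometryEquiv.norm_map, LinearIsometryEquiv.norm_map, mul_pow, mul_pow,
      Real.sq_sqrt hα.le, Real.sq_sqrt hβ.le, PiLp.norm_sq_eq_of_L2, Fin.sum_univ_two,
      mul_div_cancel_left₀ _ hα.ne', mul_div_cancel_left₀ _ hβ.ne']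

theorem unitaryI_apply {α β : ℝ} (hα : 0 < α) (hβ : 0 < β) (f : H) :
    unitaryI α β hα hβ f = toHab α β hα hβ (mapI α β f) := rfl

end Unitary

/-! ### The fiber identity and the matching of eigenspaces. -/

section Fibers

open Real

theorem mem_rabi_domain_iff (Δ g : ℝ) (f : H) :
    f ∈ (rabi Δ g).domain ↔ ∀ i, f i ∈ num.domain := by
  constructor
  · intro h i
    exact (h.1.2 i).1
  · intro h
    refine ⟨⟨fun _ => trivial, fun i => ⟨h i, trivial⟩⟩, fun i => ⟨h i, ?_⟩⟩
    rw [pcomp_domain_cre_cre]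
    exact h i

theorem rabi_apply_zero {Δ g : ℝ} (f : (rabi Δ g).domain) (h : ∀ i, f.1 i ∈ num.domain) :
    rabi Δ g f 0 = (Δ : ℂ) • f.1 0 + osc ⟨f.1 0, h 0⟩ + (g : ℂ) • sumSq ⟨f.1 1, h 1⟩ := by
  have h1 : rabi Δ g f 0 =
      (Δ : ℂ) • tensor sigmaZ (everywhere LinearMap.id) ⟨f.1, f.2.1.1⟩ 0 +
        tensor 1 numHalf ⟨f.1, f.2.1.2⟩ 0 +
      (g : ℂ) • tensor sigmaX (pcomp ann ann + pcomp cre cre) ⟨f.1, f.2.2⟩ 0 := rfl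
  rw [h1, tensor_apply, tensor_apply, tensor_apply]
  simp only [sigmaX, sigmaZ, Matrix.one_fin_two, Matrix.of_apply, Matrix.cons_val',
    Matrix.cons_val_zero, Matrix.cons_val_one, Matrix.cons_val_fin_one, zero_smul, add_zero,
    zero_add, one_smul]
  rfl

theorem rabi_apply_one {Δ g : ℝ} (f : (rabi Δ g).domain) (h : ∀ i, f.1 i ∈ num.domain) :
    rabi Δ g f 1 = -(Δ : ℂ) • f.1 1 + osc ⟨f.1 1, h 1⟩ + (g : ℂ) • sumSq ⟨f.1 0, h 0⟩ := by
  have h1 : rabi Δ g f 1 =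
      (Δ : ℂ) • tensor sigmaZ (everywhere LinearMap.id) ⟨f.1, f.2.1.1⟩ 1 +
        tensor 1 numHalf ⟨f.1, f.2.1.2⟩ 1 +
      (g : ℂ) • tensor sigmaX (pcomp ann ann + pcomp cre cre) ⟨f.1, f.2.2⟩ 1 := rfl
  rw [h1, tensor_apply, tensor_apply, tensor_apply]
  simp only [sigmaX, sigmaZ, Matrix.one_fin_two, Matrix.of_apply, Matrix.cons_val',
    Matrix.cons_val_zero, Matrix.cons_val_one, Matrix.cons_val_fin_one, zero_smul, add_zero,
    zero_add, one_smul, neg_smul, smul_neg]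
  rfl

/-- The two phases in `c` differ by the factor `i`, which absorbs the `i` produced by the rotation
and makes the coupling `σ_x`. -/
theorem exp_neg_mul_I :
    Complex.exp (-(Complex.I * (π / 4 : ℝ))) * Complex.I = Complex.exp (Complex.I * (π / 4 : ℝ)) := by
  have h : Complex.I * (π / 4 : ℝ) = -(Complex.I * (π / 4 : ℝ)) + π / 2 * Complex.I := by
    push_cast
    ring
  conv_rhs => rw [h, Complex.exp_add, Complex.exp_pi_div_two_mul_I]

theorem coupling_mul_entryUp {α β : ℝ} (hα : 0 < α) (hβ : 0 < β) :
    ((1 / (2 * √(α * β)) : ℝ) : ℂ) * entryUp α = (β : ℂ)⁻¹ * entryLow β * (1 / 2) * Complex.I := by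
  have hsα : (√α : ℂ) ≠ 0 := Complex.ofReal_ne_zero.2 (by positivity)
  have hsβ : (√β : ℂ) ≠ 0 := Complex.ofReal_ne_zero.2 (by positivity)
  have h : (β : ℂ) = √β * √β := (sqrt_mul_sqrt_self_coe hβ.le).symm
  rw [entryUp, entryLow, h, Real.sqrt_mul hα.le, ← exp_neg_mul_I]
  push_cast
  field_simp

theorem coupling_mul_entryLow {α β : ℝ} (hα : 0 < α) (hβ : 0 < β) :
    ((1 / (2 * √(α * β)) : ℝ) : ℂ) * entryLow β =
      -((α : ℂ)⁻¹ * entryUp α * (1 / 2) * Complex.I) := by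
  have hsα : (√α : ℂ) ≠ 0 := Complex.ofReal_ne_zero.2 (by positivity)
  have hsβ : (√β : ℂ) ≠ 0 := Complex.ofReal_ne_zero.2 (by positivity)
  have h : (α : ℂ) = √α * √α := (sqrt_mul_sqrt_self_coe hα.le).symm
  rw [entryUp, entryLow, h, Real.sqrt_mul hα.le, ← exp_neg_mul_I]
  push_cast
  field_simp
  rw [Complex.I_sq]
  ring

theorem mapI_mem_num_domain_iff {α β : ℝ} (hα : 0 < α) (hβ : 0 < β) (u : H) :
    (∀ i, mapI α β u i ∈ num.domain) ↔ ∀ i, u i ∈ num.domain := by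
  rw [Fin.forall_fin_two, Fin.forall_fin_two, mapI_apply_zero, mapI_apply_one,
    Submodule.smul_mem_iff _ (entryUp_ne_zero hα), Submodule.smul_mem_iff _ (entryLow_ne_zero hβ),
    rot_mem_num_domain_iff, rot_mem_num_domain_iff]

/-- Stated for a variable `w`, since rewriting a vector inside a subtype would disturb its
membership proof. -/
theorem map_mk_of_eq_smul (F : num.domain →ₗ[ℂ] L2) {w x : L2} {c : ℂ} (hw : w ∈ num.domain)
    (hx : x ∈ num.domain) (h : w = c • x) : F ⟨w, hw⟩ = c • F ⟨x, hx⟩ := by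
  subst h
  exact F.map_smul c ⟨x, hx⟩

theorem combination_zero {M : Type*} [AddCommGroup M] [Module ℂ M] {Δ g μ a a' l e e' : ℂ}
    (r o s : M) (hΔ : Δ - μ = -(a * l)) (hg : g * e' = -(a * e * (1 / 2) * Complex.I))
    (ha : a * a' = 1) :
    Δ • e • r + e • o + g • e' • s - μ • e • r =
      (a * e) • (a' • o - (1 / 2 : ℂ) • Complex.I • s - l • r) := by
  rw [smul_smul g, hg, eq_add_of_sub_eq hΔ]
  have hae : a * e * a' = e := by linear_combination e * ha
  simp only [smul_sub, smul_smul (a * e) a', hae]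
  module

theorem combination_one {M : Type*} [AddCommGroup M] [Module ℂ M] {Δ g μ a a' l e e' : ℂ}
    (r o s : M) (hΔ : μ = a * l - Δ) (hg : g * e' = a * e * (1 / 2) * Complex.I)
    (ha : a * a' = 1) :
    -Δ • e • r + e • o + g • e' • s - μ • e • r =
      (a * e) • (a' • o + (1 / 2 : ℂ) • Complex.I • s - l • r) := by
  rw [smul_smul g, hg, hΔ]
  have hae : a * e * a' = e := by linear_combination e * ha
  simp only [smul_sub, smul_add, smul_smul (a * e) a', hae]
  module

/-- The upper component of `(H - μ) I = (diag(1/α, 1/β) ⊗ 1) I (Q - λ)`; as the prefactor is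
invertible, the two kernels correspond. -/
theorem rabi_mapI_zero {α β Δ g l : ℝ} {μ : ℂ} (hα : 0 < α) (hΔ : Δ - μ = -((α : ℂ)⁻¹ * l))
    (hg : g * entryLow β = -((α : ℂ)⁻¹ * entryUp α * (1 / 2) * Complex.I))
    (u : (ncho α β).domain) (h : mapI α β u.1 ∈ (rabi Δ g).domain) :
    rabi Δ g ⟨mapI α β u.1, h⟩ 0 - μ • mapI α β u.1 0 =
      ((α : ℂ)⁻¹ * entryUp α) • rot (ncho α β u 0 - (l : ℂ) • u.1 0) := by
  have hu := (mem_ncho_domain_iff α β u.1).1 u.2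
  have hw := (mem_rabi_domain_iff _ _ _).1 h
  have hr : ∀ i, rot (u.1 i) ∈ num.domain := fun i => (rot_mem_num_domain_iff _).2 (hu i)
  have e1 := rabi_apply_zero ⟨mapI α β u.1, h⟩ hw
  have e2 := map_mk_of_eq_smul osc (hw 0) (hr 0) (mapI_apply_zero α β u.1)
  have e3 := map_mk_of_eq_smul sumSq (hw 1) (hr 1) (mapI_apply_one α β u.1)
  have e4 : rot (ncho α β u 0 - (l : ℂ) • u.1 0) =
      (α : ℂ) • osc ⟨rot (u.1 0), hr 0⟩ - (1 / 2 : ℂ) • Complex.I • sumSq ⟨rot (u.1 1), hr 1⟩ -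
        (l : ℂ) • rot (u.1 0) := by
    rw [ncho_apply_zero u hu, map_sub, map_sub, map_smul, map_smul, map_smul,
      rot_osc ⟨u.1 0, hu 0⟩ (hr 0), rot_diffSq ⟨u.1 1, hu 1⟩ (hr 1)]
  have e5 : rabi Δ g ⟨mapI α β u.1, h⟩ 0 = (Δ : ℂ) • entryUp α • rot (u.1 0) +
      entryUp α • osc ⟨rot (u.1 0), hr 0⟩ + (g : ℂ) • entryLow β • sumSq ⟨rot (u.1 1), hr 1⟩ :=
    e1.trans (congrArg₂ (· + ·) (congrArg₂ (· + ·)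
      (congrArg ((Δ : ℂ) • ·) (mapI_apply_zero α β u.1)) e2) (congrArg ((g : ℂ) • ·) e3))
  rw [e4, e5, mapI_apply_zero]
  exact combination_zero _ _ _ hΔ hg (inv_mul_cancel₀ (Complex.ofReal_ne_zero.2 hα.ne'))

theorem rabi_mapI_one {α β Δ g l : ℝ} {μ : ℂ} (hβ : 0 < β) (hΔ : μ = (β : ℂ)⁻¹ * l - Δ)
    (hg : g * entryUp α = (β : ℂ)⁻¹ * entryLow β * (1 / 2) * Complex.I)
    (u : (ncho α β).domain) (h : mapI α β u.1 ∈ (rabi Δ g).domain) :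
    rabi Δ g ⟨mapI α β u.1, h⟩ 1 - μ • mapI α β u.1 1 =
      ((β : ℂ)⁻¹ * entryLow β) • rot (ncho α β u 1 - (l : ℂ) • u.1 1) := by
  have hu := (mem_ncho_domain_iff α β u.1).1 u.2
  have hw := (mem_rabi_domain_iff _ _ _).1 h
  have hr : ∀ i, rot (u.1 i) ∈ num.domain := fun i => (rot_mem_num_domain_iff _).2 (hu i)
  have e1 := rabi_apply_one ⟨mapI α β u.1, h⟩ hw
  have e2 := map_mk_of_eq_smul osc (hw 1) (hr 1) (mapI_apply_one α β u.1)
  have e3 := map_mk_of_eq_smul sumSq (hw 0) (hr 0) (mapI_apply_zero α β u.1)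
  have e4 : rot (ncho α β u 1 - (l : ℂ) • u.1 1) =
      (β : ℂ) • osc ⟨rot (u.1 1), hr 1⟩ + (1 / 2 : ℂ) • Complex.I • sumSq ⟨rot (u.1 0), hr 0⟩ -
        (l : ℂ) • rot (u.1 1) := by
    rw [ncho_apply_one u hu, map_sub, map_add, map_smul, map_smul, map_smul,
      rot_osc ⟨u.1 1, hu 1⟩ (hr 1), rot_diffSq ⟨u.1 0, hu 0⟩ (hr 0)]
  have e5 : rabi Δ g ⟨mapI α β u.1, h⟩ 1 = -(Δ : ℂ) • entryLow β • rot (u.1 1) +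
      entryLow β • osc ⟨rot (u.1 1), hr 1⟩ + (g : ℂ) • entryUp α • sumSq ⟨rot (u.1 0), hr 0⟩ :=
    e1.trans (congrArg₂ (· + ·) (congrArg₂ (· + ·)
      (congrArg (-(Δ : ℂ) • ·) (mapI_apply_one α β u.1)) e2) (congrArg ((g : ℂ) • ·) e3))
  rw [e4, e5, mapI_apply_one]
  exact combination_one _ _ _ hΔ hg (inv_mul_cancel₀ (Complex.ofReal_ne_zero.2 hβ.ne'))

theorem mem_eigenspace_rabi_iff {α β Δ g l : ℝ} {μ : ℂ} (hα : 0 < α) (hβ : 0 < β)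
    (hΔ : Δ - μ = -((α : ℂ)⁻¹ * l)) (hΔ' : μ = (β : ℂ)⁻¹ * l - Δ)
    (hg : g * entryLow β = -((α : ℂ)⁻¹ * entryUp α * (1 / 2) * Complex.I))
    (hg' : g * entryUp α = (β : ℂ)⁻¹ * entryLow β * (1 / 2) * Complex.I) (v : H) :
    mapI α β v ∈ eigenspace (rabi Δ g) μ ↔ v ∈ eigenspace (ncho α β) l := by
  have hd : mapI α β v ∈ (rabi Δ g).domain ↔ v ∈ (ncho α β).domain := by
    rw [mem_rabi_domain_iff, mem_ncho_domain_iff, mapI_mem_num_domain_iff hα hβ]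
  have hα0 : (α : ℂ)⁻¹ * entryUp α ≠ 0 :=
    mul_ne_zero (inv_ne_zero (Complex.ofReal_ne_zero.2 hα.ne')) (entryUp_ne_zero hα)
  have hβ0 : (β : ℂ)⁻¹ * entryLow β ≠ 0 :=
    mul_ne_zero (inv_ne_zero (Complex.ofReal_ne_zero.2 hβ.ne')) (entryLow_ne_zero hβ)
  have key : ∀ (hx : v ∈ (ncho α β).domain) (hw : mapI α β v ∈ (rabi Δ g).domain),
      rabi Δ g ⟨mapI α β v, hw⟩ = μ • mapI α β v ↔ ncho α β ⟨v, hx⟩ = (l : ℂ) • v := by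
    intro hx hw
    have h0 := rabi_mapI_zero hα hΔ hg ⟨v, hx⟩ hw
    have h1 := rabi_mapI_one hβ hΔ' hg' ⟨v, hx⟩ hw
    constructor
    · intro h
      refine ext_H ?_ ?_
      · rw [h, PiLp.smul_apply, sub_self, eq_comm, smul_eq_zero_iff_right hα0,
          LinearIsometryEquiv.map_eq_zero_iff] at h0
        exact sub_eq_zero.1 h0
      · rw [h, PiLp.smul_apply, sub_self, eq_comm, smul_eq_zero_iff_right hβ0,
          LinearIsometryEquiv.map_eq_zero_iff] at h1
        exact sub_eq_zero.1 h1
    · intro h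
      refine ext_H ?_ ?_
      · rw [h, PiLp.smul_apply, sub_self, map_zero, smul_zero] at h0
        exact sub_eq_zero.1 h0
      · rw [h, PiLp.smul_apply, sub_self, map_zero, smul_zero] at h1
        exact sub_eq_zero.1 h1
  constructor
  · rintro ⟨hw, h⟩
    exact ⟨hd.1 hw, (key (hd.1 hw) hw).1 h⟩
  · rintro ⟨hx, h⟩
    exact ⟨hd.2 hx, (key hx (hd.2 hx)).2 h⟩

/-- The values of `Δ` and `μ` solve `μ - Δ = λ/α` and `μ + Δ = λ/β`. -/
theorem mapI_mem_eigenspace_rabi_iff {α β : ℝ} (hα : 0 < α) (hβ : 0 < β) (l : ℝ) (v : H) :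
    mapI α β v ∈ eigenspace (rabi ((α - β) / (2 * α * β) * l) (1 / (2 * √(α * β))))
      (fiberValue α β l) ↔ v ∈ eigenspace (ncho α β) l := by
  have hα0 : (α : ℂ) ≠ 0 := Complex.ofReal_ne_zero.2 hα.ne'
  have hβ0 : (β : ℂ) ≠ 0 := Complex.ofReal_ne_zero.2 hβ.ne'
  refine mem_eigenspace_rabi_iff hα hβ ?_ ?_ (coupling_mul_entryLow hα hβ)
    (coupling_mul_entryUp hα hβ) v
  all_goals
    rw [fiberValue]
    push_cast
    field_simp
    ring

end Fibers

/-! ### Assembly of the decomposition. -/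

/-- Eigenspaces of different fibers thereby become eigenspaces of one symmetric operator, which is
why they are orthogonal in the weighted product. -/
theorem eigenspace_rabiFiber {α β : ℝ} (hα : 0 < α) (hβ : 0 < β) (l : ℝ) :
    eigenspace (rabiFiber α β hα hβ l) (fiberValue α β l) =
      eigenspace (conj (unitaryI α β hα hβ).toLinearEquiv (ncho α β)) l := by
  refine Submodule.ext fun x => ?_
  obtain ⟨v, rfl⟩ := (unitaryI α β hα hβ).surjective x
  rw [rabiFiber, mem_eigenspace_conj, mem_eigenspace_conj, unitaryI_apply,
    LinearEquiv.symm_apply_apply, mapI_mem_eigenspace_rabi_iff hα hβ, ← unitaryI_apply]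
  exact iff_of_eq (congrArg (· ∈ eigenspace (ncho α β) l)
    ((unitaryI α β hα hβ).symm_apply_apply v).symm)

theorem isHilbertSum_congr {ι E : Type*} [NormedAddCommGroup E] [InnerProductSpace ℂ E]
    [CompleteSpace E]
    {F G : ι → Submodule ℂ E} (h : F = G)
    (hG : IsHilbertSum ℂ (fun i => G i) fun i => (G i).subtypeₗᵢ) :
    IsHilbertSum ℂ (fun i => F i) fun i => (F i).subtypeₗᵢ := by
  subst h
  exact hG

theorem fiberValue_mul {α β : ℝ} (hα : 0 < α) (hβ : 0 < β) (l : ℝ) :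
    ((2 * α * β / (α + β) : ℝ) : ℂ) * fiberValue α β l = l := by
  rw [fiberValue, ← Complex.ofReal_mul]
  congr 1
  have : α + β ≠ 0 := by positivity
  field_simp

/-- The projected fiber is defined everywhere, the projection landing in an eigenspace. Keeping `P`
a variable lets the projection be expressed through the conjugated oscillator. -/
theorem smul_projectedFiber_apply {α β : ℝ} (hα : 0 < α) (hβ : 0 < β) (l : ℝ)
    {P : Hab α β hα hβ →L[ℂ] Hab α β hα hβ}
    (hP : eigenprojection (rabiFiber α β hα hβ l) (fiberValue α β l) = P) (x : Hab α β hα hβ)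
    (hx : P x ∈ eigenspace (rabiFiber α β hα hβ l) (fiberValue α β l)) :
    ∃ h : x ∈ (projectedFiber α β hα hβ l).domain,
      ((2 * α * β / (α + β) : ℝ) : ℂ) • projectedFiber α β hα hβ l ⟨x, h⟩ = (l : ℂ) • P x := by
  subst hP
  obtain ⟨hd, hv⟩ := hx
  refine ⟨⟨trivial, hd⟩, ?_⟩
  rw [← fiberValue_mul hα hβ l, mul_smul]
  exact congrArg (((2 * α * β / (α + β) : ℝ) : ℂ) • ·) hv

theorem eigenspace_conj_ne_bot_iff {E F : Type*} [AddCommGroup E] [Module ℂ E] [AddCommGroup F]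
    [Module ℂ F] (e : E ≃ₗ[ℂ] F) (T : E →ₗ.[ℂ] E) (μ : ℂ) :
    eigenspace (conj e T) μ ≠ ⊥ ↔ eigenspace T μ ≠ ⊥ := by
  rw [Submodule.ne_bot_iff, Submodule.ne_bot_iff]
  constructor
  · rintro ⟨x, hx, h0⟩
    exact ⟨e.symm x, (mem_eigenspace_conj e T μ x).1 hx, e.symm.map_ne_zero_iff.2 h0⟩
  · rintro ⟨x, hx, h0⟩
    refine ⟨e x, (mem_eigenspace_conj e T μ _).2 ?_, e.map_ne_zero_iff.2 h0⟩
    rwa [e.symm_apply_apply]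

end NcHO

theorem theorem3 (α β : ℝ) (hα : 0 < α) (hβ : 0 < β) (hαβ : 1 < α * β) :
    -- the spectrum of the non-commutative harmonic oscillator is real
    (∀ z ∈ NcHO.spectrum (NcHO.ncho α β), z.im = 0) ∧
    -- `(α + β) λ / (2 α β)` is an eigenvalue of the fiber at each `λ` in the spectrum
    (∀ l ∈ NcHO.nchoSpectrum α β,
      NcHO.eigenspace (NcHO.rabiFiber α β hα hβ l) (NcHO.fiberValue α β l) ≠ ⊥) ∧
    -- the weighted space is the Hilbert direct sum of these eigenspaces
    IsHilbertSum ℂ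
      (fun l : NcHO.nchoSpectrum α β =>
        NcHO.eigenspace (NcHO.rabiFiber α β hα hβ l) (NcHO.fiberValue α β l))
      (fun l : NcHO.nchoSpectrum α β =>
        (NcHO.eigenspace (NcHO.rabiFiber α β hα hβ l) (NcHO.fiberValue α β l)).subtypeₗᵢ) ∧
    -- `c ⊗ exp(-i (π/4) a* a)` is unitary onto the weighted space, and the fiber decomposition
    ∃ I : NcHO.H ≃ₗᵢ[ℂ] NcHO.Hab α β hα hβ,
      (∀ f, I f = NcHO.toHab α β hα hβ (NcHO.mapI α β f)) ∧
      NcHO.conj I.toLinearEquiv (NcHO.ncho α β) =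
        ((2 * α * β / (α + β) : ℝ) : ℂ) •
          NcHO.directSum fun l : NcHO.nchoSpectrum α β => NcHO.projectedFiber α β hα hβ l := by
  obtain ⟨c, R, h⟩ := NcHO.exists_isCompactResolvent_ncho hα hβ hαβ
  have hT := NcHO.isFormalAdjoint_ncho α β
  obtain ⟨R', h'⟩ := h.conj (NcHO.unitaryI α β hα hβ)
  have hT' := NcHO.isFormalAdjoint_conj hT (NcHO.unitaryI α β hα hβ)
  have heig := NcHO.eigenspace_rabiFiber hα hβ
  -- The index set, defined as a spectrum, is the set of real eigenvalues because the resolvent is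
  -- compact.
  have hS : ∀ l : ℝ, NcHO.eigenspace
      (NcHO.conj (NcHO.unitaryI α β hα hβ).toLinearEquiv (NcHO.ncho α β)) l ≠ ⊥ ↔
      l ∈ NcHO.nchoSpectrum α β := fun l =>
    (NcHO.eigenspace_conj_ne_bot_iff _ _ _).trans (h.mem_spectrum_iff l).symm
  refine ⟨fun z hz => NcHO.im_eq_zero_of_eigenspace_ne_bot hT ((h.mem_spectrum_iff z).1 hz),
    fun l hl => (heig l).symm ▸ (hS l).2 hl,
    NcHO.isHilbertSum_congr (funext fun l => heig l) (h'.isHilbertSum hT' fun l => (hS l).1),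
    NcHO.unitaryI α β hα hβ, fun f => rfl,
    h'.eq_smul_directSum hT' (fun l => (hS l).1) ?_ fun l x => ?_⟩
  · exact Complex.ofReal_ne_zero.2 (by positivity)
  · refine NcHO.smul_projectedFiber_apply hα hβ l (NcHO.eigenprojection_congr (heig l)) x ?_
    rw [heig]
    exact h'.eigenprojection_mem _ x
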